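/- **Setting.** A *marriage instance* $T$ consists of finite disjoint sets $X,Y$ of agents, a set of edges $xy$ ($x\in X$, $y\in Y$; we write $xy\in T$), and for every agent $z$ a strict linear order $>_z$ on its preference list, i.e. on the agents joined to $z$ by an edge; every listed agent is preferred to being unmatched ($\emptyset$). A *subtable* $T'\subseteq T$ is given by a subset of the edges with the induced orders. A *matching* of $T$ is a set $M$ of pairwise disjoint edges of $T$; $M(z)\in X\cup Y\cup\{\emptyset\}$ is the partner of $z$. An edge $xy\in T$ *blocks* $M$ if $y>_xM(x)$ and $x>_yM(y)$; a matching $M'$ blocks $M$ if some edge of $M'$ does. $\mathcal M(T)$ and $\mathcal S(T)$ are the sets of all matchings and of all stable (unblocked) matchings of $T$. $T$ is a *stable table* if each of its edges lies in some $M\in\mathcal S(T)$. For $Z\in\{X,Y\}$ write $M\preceq_Z M'$ if every $z\in Z$ weakly prefers $M'$ to $M$; $M_Z^{T}$ denotes the $\preceq_Z$-greatest element of $\mathcal S(T)$. A set $\mathcal M'\subseteq\mathcal M(T)$ is *internally stable* if no member blocks another, and *internally closed* if it is internally stable and equals $\{M\in\mathcal M(T):\{M\}\cup\mathcal M'\text{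 is internally stable}\}$. It is *closed under join* if $M\vee M'\in\mathcal M'$ for all $M,M'\in\mathcal M'$, where $M\vee M'$ is the set of edges that pairs each $x\in X$ with the better of $M(x),M'(x)$; it satisfies *opposition of interests* if for all $M,M'\in\mathcal M'$: $M'\preceq_XM\iff M\preceq_YM'$. An *$X$-rotation of $T$ exposed in $M\in\mathcal S(T)$* is a non-empty sequence $\rho=(x_0,y_0),\dots,(x_{r-1},y_{r-1})$, taken up to cyclic shift, with distinct $x_i$ and distinct $y_i$, such that for all $i$ (mod $r$): $x_iy_i\in M$; $x_i>_{y_{i+1}}x_{i+1}$; $y_i>_{x_i}y_{i+1}$; and $M(y)>_yx_i$ for every $y$ with $x_iy\in T$ and $y_i>_{x_i}y>_{x_i}y_{i+1}$. $R_X(T)$ is the set of $X$-rotations exposed in some $M\in\mathcal S(T)$. Put $E(\rho)=\{x_iy_i\}_i\cup\{x_iy_{i+1}\}_i$, and let $M/\rho$ be obtained from $M$ by rematching each $x_i$ to $y_{i+1}$. For a finite set $R$ of rotations, $M/R$ is the result of eliminating the elements of $R$ one after another, in an order in which each one is exposed when it is eliminated. For $\rho\in R_X(T)$, $R(\rho)$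 is the set of $\rho'\in R_X(T)\setminus\{\rho\}$ that are eliminated before $\rho$ in every sequence of eliminations starting at $M_X^T$ that contains both. For a stable table $T'\subseteq T$ and $\rho\in R_X(T')$, a *dissecting set* for $(T,T',\rho)$ is a finite set $R$ with $E(\sigma)\subseteq T$ for all $\sigma\in R$ such that, with $T^*=T'\cup\bigcup_{\sigma\in R}E(\sigma)$, $R\subseteq R_X(T^*)\setminus R_X(T')$ and $M_X^{T'}/R(\rho)/\rho=M_X^{T'}/R(\rho)/R$, where $R(\rho)$ and the eliminations of $R(\rho)$ and $\rho$ refer to $T'$ and those of $R$ refer to $T^*$. The problem $\mathrm{DR}(T,T',\rho)$ returns a dissecting set if there is one, and $\{\rho\}$ otherwise. For $M\in\mathcal M(T)$, the digraph $D_X(M,T)$ on $X\cup Y$ has an arc $x\to y$ whenever $xy\in T$, $x>_yM(y)$ and $M(x)>_xy$, and an arc $y\to x$ whenever $xy\in M$; $D_Y(M,T)$ is defined in the same way with the roles of $X$ and $Y$ exchanged. **Theorem.** Let $T$ be a marriage instance and $\mathcal M'\subseteq\mathcal M(T)$. The following are equivalent. 1. $\mathcal M'$ is internally closed. 2. $\mathcal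 M'$ is inclusionwise maximal among the subsets of $\mathcal M(T)$ that are closed under join and satisfy opposition of interests. 3. $\mathcal M'=\mathcal S(T')$ for a stable table $T'\subseteq T$ such that (a) $D_X(M_Y^{T'},T)$ and $D_Y(M_X^{T'},T)$ have no directed cycle, and (b) $\mathrm{DR}(T,T',\rho)$ returns $\{\rho\}$ for all $\rho\in R_X(T')$. -/

import Mathlib

/-- A marriage instance (preference table) with the two sides `X` and `Y`: the set of edges
(mutually acceptable pairs) and, for each agent, a strict linear order on its preference list.
`prefX x y y'` reads `y >_x y'` and `prefY y x x'` reads `x >_y x'`; both relations only hold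
between agents of the preference list in question. -/
structure MarriageTable (X Y : Type*) where
  edges : Set (X × Y)
  prefX : X → Y → Y → Prop
  prefY : Y → X → X → Prop
  prefX_left : ∀ x y y', prefX x y y' → (x, y) ∈ edges
  prefX_right : ∀ x y y', prefX x y y' → (x, y') ∈ edges
  prefX_irrefl : ∀ x y, ¬ prefX x y y
  prefX_trans : ∀ x y y' y'', prefX x y y' → prefX x y' y'' → prefX x y y''
  prefX_total : ∀ x y y', (x, y) ∈ edges → (x, y') ∈ edges → y ≠ y' →
    prefX x y y' ∨ prefX x y' y
  prefY_left : ∀ y x x', prefY y x x' → (x, y) ∈ edges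
  prefY_right : ∀ y x x', prefY y x x' → (x', y) ∈ edges
  prefY_irrefl : ∀ y x, ¬ prefY y x x
  prefY_trans : ∀ y x x' x'', prefY y x x' → prefY y x' x'' → prefY y x x''
  prefY_total : ∀ y x x', (x, y) ∈ edges → (x', y) ∈ edges → x ≠ x' →
    prefY y x x' ∨ prefY y x' x

namespace MarriageTable

variable {X Y : Type*}

/-! ### Subtables -/

/-- `T' ⊆ T`: every edge of `T'` is an edge of `T`, and the preference lists are consistent. -/
def IsSubtable (T' T : MarriageTable X Y) : Prop :=
  T'.edges ⊆ T.edges ∧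
  (∀ x y y', (x, y) ∈ T'.edges → (x, y') ∈ T'.edges → (T'.prefX x y y' ↔ T.prefX x y y')) ∧
  (∀ y x x', (x, y) ∈ T'.edges → (x', y) ∈ T'.edges → (T'.prefY y x x' ↔ T.prefY y x x'))

/-- The subtable of `T` whose edges are the edges of `T` that lie in `E`. -/
def restrict (T : MarriageTable X Y) (E : Set (X × Y)) : MarriageTable X Y where
  edges := T.edges ∩ E
  prefX x y y' := (x, y) ∈ E ∧ (x, y') ∈ E ∧ T.prefX x y y'
  prefY y x x' := (x, y) ∈ E ∧ (x', y) ∈ E ∧ T.prefY y x x'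
  prefX_left x y y' h := ⟨T.prefX_left x y y' h.2.2, h.1⟩
  prefX_right x y y' h := ⟨T.prefX_right x y y' h.2.2, h.2.1⟩
  prefX_irrefl x y h := T.prefX_irrefl x y h.2.2
  prefX_trans x y y' y'' h h' := ⟨h.1, h'.2.1, T.prefX_trans x y y' y'' h.2.2 h'.2.2⟩
  prefX_total x y y' h h' hne :=
    (T.prefX_total x y y' h.1 h'.1 hne).imp (fun k => ⟨h.2, h'.2, k⟩) (fun k => ⟨h'.2, h.2, k⟩)
  prefY_left y x x' h := ⟨T.prefY_left y x x' h.2.2, h.1⟩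
  prefY_right y x x' h := ⟨T.prefY_right y x x' h.2.2, h.2.1⟩
  prefY_irrefl y x h := T.prefY_irrefl y x h.2.2
  prefY_trans y x x' x'' h h' := ⟨h.1, h'.2.1, T.prefY_trans y x x' x'' h.2.2 h'.2.2⟩
  prefY_total y x x' h h' hne :=
    (T.prefY_total y x x' h.1 h'.1 hne).imp (fun k => ⟨h.2, h'.2, k⟩) (fun k => ⟨h'.2, h.2, k⟩)

/-! ### Matchings, stability and internal closedness

A matching is a set of edges; `M(x) = y` is `(x, y) ∈ M`, and `M(x) = ∅` means that no edge of
`M` contains `x`. Being unmatched is worse than every acceptable partner. -/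

/-- The set `𝓜(T)` of matchings of `T`. -/
def matchings (T : MarriageTable X Y) : Set (Set (X × Y)) :=
  {M | M ⊆ T.edges ∧ (∀ x y y', (x, y) ∈ M → (x, y') ∈ M → y = y') ∧
    (∀ y x x', (x, y) ∈ M → (x', y) ∈ M → x = x')}

/-- `xy` is a blocking pair for `M`: it is an edge of `T` with `y >_x M(x)` and `x >_y M(y)`. -/
def IsBlockingPair (T : MarriageTable X Y) (M : Set (X × Y)) (x : X) (y : Y) : Prop :=
  (x, y) ∈ T.edges ∧ (∀ y', (x, y') ∈ M → T.prefX x y y') ∧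
    (∀ x', (x', y) ∈ M → T.prefY y x x')

/-- The set `𝓢(T)` of stable matchings of `T`. -/
def stableMatchings (T : MarriageTable X Y) : Set (Set (X × Y)) :=
  {M | M ∈ T.matchings ∧ ∀ x y, ¬ T.IsBlockingPair M x y}

/-- `T` is a stable table: each of its edges lies in a stable matching of `T`. -/
def IsStableTable (T : MarriageTable X Y) : Prop :=
  ∀ e ∈ T.edges, ∃ M ∈ T.stableMatchings, e ∈ M

/-- The matching `M'` blocks the matching `M`: `M'` contains a blocking pair for `M`. -/
def Blocks (T : MarriageTable X Y) (M' M : Set (X × Y)) : Prop :=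
  ∃ x y, (x, y) ∈ M' ∧ T.IsBlockingPair M x y

def InternallyStable (T : MarriageTable X Y) (N : Set (Set (X × Y))) : Prop :=
  ∀ M₀ ∈ N, ∀ M₁ ∈ N, ¬ T.Blocks M₀ M₁ ∧ ¬ T.Blocks M₁ M₀

/-- The closure of a set `N` of matchings: all matchings `M` such that `{M} ∪ N` is internally
stable. -/
def internalClosure (T : MarriageTable X Y) (N : Set (Set (X × Y))) : Set (Set (X × Y)) :=
  {M | M ∈ T.matchings ∧ T.InternallyStable ({M} ∪ N)}

def InternallyClosed (T : MarriageTable X Y) (N : Set (Set (X × Y))) : Prop :=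
  T.InternallyStable N ∧ T.internalClosure N = N

/-! ### Domination, join, opposition of interests -/

/-- `M ⪯_X M'`: every `x` weakly prefers `M'` to `M`. -/
def LeX (T : MarriageTable X Y) (M M' : Set (X × Y)) : Prop :=
  ∀ x y, (x, y) ∈ M → ∃ y', (x, y') ∈ M' ∧ (y' = y ∨ T.prefX x y' y)

/-- `M ⪯_Y M'`: every `y` weakly prefers `M'` to `M`. -/
def LeY (T : MarriageTable X Y) (M M' : Set (X × Y)) : Prop :=
  ∀ x y, (x, y) ∈ M → ∃ x', (x', y) ∈ M' ∧ (x' = x ∨ T.prefY y x' x)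

/-- `M` is the `X`-optimal stable matching of `T`. -/
def IsXOptimal (T : MarriageTable X Y) (M : Set (X × Y)) : Prop :=
  M ∈ T.stableMatchings ∧ ∀ M' ∈ T.stableMatchings, T.LeX M' M

/-- `M` is the `Y`-optimal stable matching of `T`. -/
def IsYOptimal (T : MarriageTable X Y) (M : Set (X × Y)) : Prop :=
  M ∈ T.stableMatchings ∧ ∀ M' ∈ T.stableMatchings, T.LeY M' M

/-- The join of two matchings: every `x` is paired with the better of its partners in `M` and
`M'`. In general this is not a matching. -/
def join (T : MarriageTable X Y) (M M' : Set (X × Y)) : Set (X × Y) :=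
  {e | e ∈ M ∪ M' ∧ (∀ y, (e.1, y) ∈ M → e.2 = y ∨ T.prefX e.1 e.2 y) ∧
    (∀ y, (e.1, y) ∈ M' → e.2 = y ∨ T.prefX e.1 e.2 y)}

def JoinClosed (T : MarriageTable X Y) (N : Set (Set (X × Y))) : Prop :=
  ∀ M ∈ N, ∀ M' ∈ N, T.join M M' ∈ N

def OppositionOfInterests (T : MarriageTable X Y) (N : Set (Set (X × Y))) : Prop :=
  ∀ M ∈ N, ∀ M' ∈ N, T.LeX M' M ↔ T.LeY M M'

/-! ### Rotations -/

/-- Sequences of pairs `(x₀, y₀), …, (x_{r-1}, y_{r-1})` up to a cyclic shift of the indices. -/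
abbrev PairCycle (X Y : Type*) := Cycle (X × Y)

/-- In the cyclic sequence `ρ`, the pair `p` is followed by the pair `q`; that is,
`p = (x_i, y_i)` and `q = (x_{i+1}, y_{i+1})` for some `i`, with indices modulo `r`. -/
def Follows (ρ : PairCycle X Y) (p q : X × Y) : Prop :=
  ∃ l : List (X × Y), ρ = ((p :: l : List (X × Y)) : Cycle (X × Y)) ∧
    (l ++ [p]).head? = some q

/-- The edges `x_i y_{i+1}` of a cyclic sequence of pairs. -/
def shiftEdges (ρ : PairCycle X Y) : Set (X × Y) :=
  {e | ∃ p q, Follows ρ p q ∧ e = (p.1, q.2)}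

/-- `E(ρ)`: the edges `x_i y_i` and `x_i y_{i+1}`. -/
def rotEdges (ρ : PairCycle X Y) : Set (X × Y) :=
  {e | e ∈ ρ} ∪ shiftEdges ρ

/-- `ρ` is a (classical) `X`-rotation exposed in the stable matching `M` of `T`. -/
def Exposed (T : MarriageTable X Y) (M : Set (X × Y)) (ρ : PairCycle X Y) : Prop :=
  M ∈ T.stableMatchings ∧ ρ ≠ Cycle.nil ∧
  (ρ.map Prod.fst).Nodup ∧ (ρ.map Prod.snd).Nodup ∧
  (∀ p ∈ ρ, p ∈ M) ∧
  ∀ p q, Follows ρ p q →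
    T.prefY q.2 p.1 q.1 ∧ T.prefX p.1 p.2 q.2 ∧
    ∀ y, (p.1, y) ∈ T.edges → T.prefX p.1 p.2 y → T.prefX p.1 y q.2 →
      ∃ x, (x, y) ∈ M ∧ T.prefY y x p.1

/-- The set `R_X(T)` of `X`-rotations exposed in some stable matching of `T`. -/
def rotations (T : MarriageTable X Y) : Set (PairCycle X Y) :=
  {ρ | ∃ M, T.Exposed M ρ}

/-- The elimination `M / ρ`: each `x_i` is rematched to `y_{i+1}`, and every `x ∉ ρ` keeps its
partner. -/
def eliminate (M : Set (X × Y)) (ρ : PairCycle X Y) : Set (X × Y) :=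
  {e | e ∈ M ∧ ∀ p ∈ ρ, p.1 ≠ e.1} ∪ shiftEdges ρ

/-- `EliminatesTo T M [ρ₁, …, ρ_k] M'`: each `ρ_i` is an `X`-rotation of `T` exposed in
`M / ρ₁ / ⋯ / ρ_{i-1}`, and `M' = M / ρ₁ / ⋯ / ρ_k`. -/
def EliminatesTo (T : MarriageTable X Y) :
    Set (X × Y) → List (PairCycle X Y) → Set (X × Y) → Prop
  | M, [], M' => M' = M
  | M, ρ :: l, M' => T.Exposed M ρ ∧ EliminatesTo T (eliminate M ρ) l M'

/-- `M' = M / R` for a set `R` of `X`-rotations of `T`: the elements of `R` can be eliminated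
from `M` in some order, and this leads to `M'`. -/
def EliminatesSetTo (T : MarriageTable X Y) (M : Set (X × Y)) (R : Set (PairCycle X Y))
    (M' : Set (X × Y)) : Prop :=
  ∃ l : List (PairCycle X Y), l.Nodup ∧ {ρ | ρ ∈ l} = R ∧ T.EliminatesTo M l M'

/-- `ρ' ⊏ ρ` in the rotation poset of `T`: the two are different, and in every sequence of
eliminations that starts at the `X`-optimal stable matching and contains both of them, `ρ'` is
eliminated before `ρ`. -/
def RotPrecedes (T : MarriageTable X Y) (ρ' ρ : PairCycle X Y) : Prop :=
  ρ' ≠ ρ ∧ ∀ (M M' : Set (X × Y)) (l : List (PairCycle X Y)), T.IsXOptimal M →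
    T.EliminatesTo M l M' → ρ' ∈ l → ρ ∈ l → [ρ', ρ].Sublist l

/-- `R(ρ)`: the rotations of `T` that strictly precede `ρ`. -/
def rotPredecessors (T : MarriageTable X Y) (ρ : PairCycle X Y) : Set (PairCycle X Y) :=
  {ρ' | ρ' ∈ T.rotations ∧ T.RotPrecedes ρ' ρ}

/-! ### Generalized rotation digraphs -/

/-- The arcs of the digraph `D_X(M, T)` on `X ∪ Y`: an arc `x → y` for every edge `xy` of `T` with
`x >_y M(y)` and `M(x) >_x y`, and an arc `y → x` for `xy ∈ M`. -/
def ArcX (T : MarriageTable X Y) (M : Set (X × Y)) : X ⊕ Y → X ⊕ Y → Prop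
  | Sum.inl x, Sum.inr y => (x, y) ∈ T.edges ∧ (∀ x', (x', y) ∈ M → T.prefY y x x') ∧
      ∃ y', (x, y') ∈ M ∧ T.prefX x y' y
  | Sum.inr y, Sum.inl x => (x, y) ∈ M
  | _, _ => False

/-- The arcs of the digraph `D_Y(M, T)` on `X ∪ Y`: an arc `y → x` for every edge `xy` of `T` with
`y >_x M(x)` and `M(y) >_y x`, and an arc `x → y` for `xy ∈ M`. -/
def ArcY (T : MarriageTable X Y) (M : Set (X × Y)) : X ⊕ Y → X ⊕ Y → Prop
  | Sum.inr y, Sum.inl x => (x, y) ∈ T.edges ∧ (∀ y', (x, y') ∈ M → T.prefX x y y') ∧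
      ∃ x', (x', y) ∈ M ∧ T.prefY y x' x
  | Sum.inl x, Sum.inr y => (x, y) ∈ M
  | _, _ => False

/-- The digraph with the given arc relation has no directed cycle. -/
def Acyclic {V : Type*} (arc : V → V → Prop) : Prop :=
  ∀ v, ¬ Relation.TransGen arc v v

/-! ### Dissecting a rotation -/

/-- The subtable `T' ∪ ⋃_{ρ ∈ R} E(ρ)` of `T`. -/
def augment (T T' : MarriageTable X Y) (R : Set (PairCycle X Y)) : MarriageTable X Y :=
  T.restrict (T'.edges ∪ ⋃ ρ ∈ R, rotEdges ρ)

/-- `R` is a dissecting set for `(T, T', ρ)`: with `T* = T' ∪ ⋃_{σ ∈ R} E(σ)`, a subtable of `T`,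
one has `R ⊆ R_X(T*) \ R_X(T')` and `M_X / R(ρ) / ρ = M_X / R(ρ) / R`, where `M_X` is the
`X`-optimal stable matching of `T'`. -/
def IsDissectingSet (T T' : MarriageTable X Y) (ρ : PairCycle X Y)
    (R : Set (PairCycle X Y)) : Prop :=
  (∀ σ ∈ R, rotEdges σ ⊆ T.edges) ∧
  R ⊆ (augment T T' R).rotations \ T'.rotations ∧
  ∃ MX M₀ M₁ : Set (X × Y), T'.IsXOptimal MX ∧
    T'.EliminatesSetTo MX (T'.rotPredecessors ρ) M₀ ∧
    T'.EliminatesTo M₀ [ρ] M₁ ∧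
    (augment T T' R).EliminatesSetTo M₀ R M₁

/-- `R` is a correct output of the problem of dissecting the rotation `ρ`: a dissecting set, or
`{ρ}` if there is no dissecting set. -/
def IsDROutput (T T' : MarriageTable X Y) (ρ : PairCycle X Y)
    (R : Set (PairCycle X Y)) : Prop :=
  IsDissectingSet T T' ρ R ∨ ((¬ ∃ R', IsDissectingSet T T' ρ R') ∧ R = {ρ})

end MarriageTable

namespace MarriageTable

variable {X Y : Type*}

/-! ### Cyclic sequences of pairs -/

/-! Two matchings that do not block each other behave like two stable matchings of one table. An
edge of one matching whose `X`-end prefers that matching has a `Y`-end preferring the other, and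
counting on finite sides makes this a bijection (`Compatible.surjective`). So both matchings cover
the same agents, interests are opposed, and stable matchings form a lattice.

An internally closed family consists of all stable matchings of the table of its own edges
(`InternallyClosed.eq_stableMatchings`), hence it is closed under join. Conversely, join and
opposition together exclude blocking. This gives the equivalence with maximality.

For the third condition, ask which matchings `M` are compatible with all stable matchings of `T'`
but missing among them. A cycle in one of the two digraphs can be rotated and yields a matching
beyond an extreme one. If there are no cycles, every compatible `M` lies between `MX` and `MY`, and
a missing `M` uses an edge `xy` outside `T'`. On a chain of eliminations from `MX` to `MY`, some
rotation `ρ` carries `x` past `y`. Let `M₀` arise by eliminating the predecessors of `ρ`, and `M₁`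
from `M₀` by eliminating `ρ`. In the table `T' ∪ M` the stable matching `(M ∨ M₁) ∧ M₀` lies between
`M₁` and `M₀` and contains `xy`; the rotations met on a descent through it dissect `ρ`
(`exists_isDissectingSet_of_mem`). Conversely, the first rotation eliminated in a dissecting set
would produce a missing matching (`not_isDissectingSet`).

Behind this is the absence of gaps in a stable table: nothing lies between `y_i` and `y_{i+1}` for
`x_i`, nor between `x_i` and `x_{i+1}` for `y_{i+1}`. Hence rotations are disjoint, and each occurs
on every full chain. -/

theorem exists_follows {ρ : PairCycle X Y} {p : X × Y} (hp : p ∈ ρ) : ∃ q, Follows ρ p q := by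
  induction ρ using Quotient.inductionOn' with
  | _ L =>
    obtain ⟨a, b, rfl⟩ := List.append_of_mem (show p ∈ L from hp)
    have h : ((a ++ p :: b : List (X × Y)) : Cycle (X × Y)) = ((p :: (b ++ a) : List (X × Y)) :) :=
      Cycle.coe_eq_coe.2 (by simpa using List.isRotated_append (l := a) (l' := p :: b))
    obtain ⟨q, hq⟩ : ∃ q, ((b ++ a) ++ [p]).head? = some q := by
      cases h : (b ++ a) ++ [p] <;> simp_all
    exact ⟨q, b ++ a, h, hq⟩

theorem Follows.mem_left {ρ : PairCycle X Y} {p q : X × Y} (h : Follows ρ p q) : p ∈ ρ := by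
  obtain ⟨l, rfl, -⟩ := h
  simp

theorem Follows.mem_right {ρ : PairCycle X Y} {p q : X × Y} (h : Follows ρ p q) : q ∈ ρ := by
  obtain ⟨l, rfl, h⟩ := h
  have := List.mem_of_mem_head? h
  simpa [or_comm] using this

open Classical in
theorem Follows.next_eq {ρ : PairCycle X Y} {p q : X × Y} (hρ : ρ.Nodup) (h : Follows ρ p q) :
    ρ.next hρ p h.mem_left = q := by
  obtain ⟨l, rfl, hq⟩ := h
  cases l with
  | nil =>
    obtain rfl : p = q := by simpa using hq
    exact List.next_singleton p p (by simp)
  | cons a l =>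
    obtain rfl : a = q := by simpa using hq
    exact List.next_cons_cons_eq _ _ _ (by simp)

theorem Follows.right_unique {ρ : PairCycle X Y} {p q q' : X × Y} (hρ : ρ.Nodup)
    (h : Follows ρ p q) (h' : Follows ρ p q') : q = q' := by
  classical
  exact (h.next_eq hρ).symm.trans (h'.next_eq hρ)

theorem Follows.left_unique {ρ : PairCycle X Y} {p p' q : X × Y} (hρ : ρ.Nodup)
    (h : Follows ρ p q) (h' : Follows ρ p' q) : p = p' := by
  classical
  have e := ρ.prev_next hρ p h.mem_left
  have e' := ρ.prev_next hρ p' h'.mem_left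
  simp only [h.next_eq hρ] at e
  simp only [h'.next_eq hρ] at e'
  exact e.symm.trans e'

theorem exists_follows_left {ρ : PairCycle X Y} {q : X × Y} (hρ : ρ.Nodup) (hq : q ∈ ρ) :
    ∃ p, Follows ρ p q := by
  classical
  obtain ⟨q', h⟩ := exists_follows (ρ.prev_mem hρ q hq)
  have := h.next_eq hρ
  rw [ρ.next_prev hρ] at this
  subst this
  exact ⟨_, h⟩

theorem Follows.of_chain {ρ : PairCycle X Y} {r : X × Y → X × Y → Prop} (hr : ρ.Chain r)
    {p q : X × Y} (h : Follows ρ p q) : r p q := by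
  obtain ⟨l, rfl, hq⟩ := h
  rw [Cycle.chain_coe_cons] at hr
  exact (List.isChain_cons.1 hr).1 q hq

theorem chain_follows (ρ : PairCycle X Y) : ρ.Chain (Follows ρ) := by
  induction ρ using Cycle.induction_on with
  | nil => trivial
  | cons a l _ =>
    rw [Cycle.chain_coe_cons, List.isChain_iff_forall_rel_of_append_cons_cons]
    intro c d l₁ l₂ h
    -- An empty `l₂` means that the consecutive pair `c, d` is the one closing the cycle, so `d =
    -- a`; otherwise it lies inside `a :: l`.
    rcases List.eq_nil_or_concat l₂ with rfl | ⟨l₂, b, rfl⟩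
    · have h' : (a :: l) ++ [a] = (l₁ ++ [c]) ++ [d] := by simpa using h
      obtain ⟨h₁, h₂⟩ := List.append_inj' h' rfl
      obtain rfl : a = d := by simpa using h₂
      refine ⟨l₁, ?_, by rw [← h₁]; rfl⟩
      rw [h₁]
      exact Cycle.coe_eq_coe.2 (List.isRotated_append (l := l₁) (l' := [c]))
    · have h' : (a :: l) ++ [a] = (l₁ ++ c :: d :: l₂) ++ [b] := by simpa using h
      obtain ⟨h₁, -⟩ := List.append_inj' h' rfl
      refine ⟨d :: l₂ ++ l₁, ?_, rfl⟩
      rw [h₁]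
      exact Cycle.coe_eq_coe.2 (by simpa using List.isRotated_append (l := l₁) (l' := c :: d :: l₂))

/-- A property that is passed on along a cyclic sequence holds everywhere on it once it holds
somewhere. -/
theorem forall_mem_of_follows {ρ : PairCycle X Y} {P : X × Y → Prop}
    (hP : ∀ p q, Follows ρ p q → P p → P q) {p : X × Y} (hp : p ∈ ρ) (h : P p) :
    ∀ q ∈ ρ, P q := by
  intro q hq
  have hc : ρ.Chain (fun a b => P a → P b) := (chain_follows ρ).imp fun a b => hP a b
  -- A cyclic chain for a transitive relation relates any two of its members.
  have : IsTrans (X × Y) (fun a b => P a → P b) := ⟨fun _ _ _ h h' => h' ∘ h⟩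
  exact Cycle.chain_iff_pairwise.1 hc p hp q hq h

/-- Equal successors from a common element give equal permutations `formPerm`. These determine the
cycle unless it has at most one element, which `hne` excludes. -/
theorem eq_of_follows {ρ σ : PairCycle X Y} (hρ : ρ.Nodup) (hσ : σ.Nodup) {p : X × Y}
    (hpρ : p ∈ ρ) (hpσ : p ∈ σ) (h : ∀ p q q', Follows ρ p q → Follows σ p q' → q = q')
    (hne : ∀ p, ¬ Follows ρ p p) : ρ = σ := by
  classical
  have h₁ : ∀ q ∈ ρ, q ∈ σ := forall_mem_of_follows (fun a b hab ha => by
    obtain ⟨c, hc⟩ := exists_follows ha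
    exact h a b c hab hc ▸ hc.mem_right) hpρ hpσ
  have h₂ : ∀ q ∈ σ, q ∈ ρ := forall_mem_of_follows (fun a b hab ha => by
    obtain ⟨c, hc⟩ := exists_follows ha
    exact h a c b hc hab ▸ hc.mem_right) hpσ hpρ
  have key : ρ.formPerm hρ = σ.formPerm hσ := by
    ext1 q
    by_cases hq : q ∈ ρ
    · obtain ⟨a, ha⟩ := exists_follows hq
      obtain ⟨b, hb⟩ := exists_follows (h₁ q hq)
      rw [Cycle.formPerm_apply_mem_eq_next _ _ _ hq,
        Cycle.formPerm_apply_mem_eq_next _ _ _ (h₁ q hq), ha.next_eq hρ, hb.next_eq hσ]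
      exact h q a b ha hb
    · rw [Cycle.formPerm_eq_self_of_notMem _ _ _ hq,
        Cycle.formPerm_eq_self_of_notMem _ _ _ fun h => hq (h₂ q h)]
  refine (Cycle.formPerm_eq_formPerm_iff.1 key).resolve_right fun hs => ?_
  obtain ⟨q, hq⟩ := exists_follows hpρ
  obtain rfl := hs.1.congr hq.mem_left hq.mem_right
  exact hne _ hq

theorem nodup_of_map {α β : Type*} {f : α → β} {s : Cycle α} (h : (s.map f).Nodup) : s.Nodup := by
  induction s using Quotient.inductionOn' with
  | _ L => exact List.Nodup.of_map f h

theorem eq_of_nodup_map {α β : Type*} {f : α → β} {s : Cycle α} (h : (s.map f).Nodup) {a b : α}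
    (ha : a ∈ s) (hb : b ∈ s) (hab : f a = f b) : a = b := by
  induction s using Quotient.inductionOn' with
  | _ L => exact List.inj_on_of_nodup_map h ha hb hab

theorem nodup_map_of_injOn {α β : Type*} {f : α → β} {s : Cycle α} (hs : s.Nodup)
    (h : ∀ a ∈ s, ∀ b ∈ s, f a = f b → a = b) : (s.map f).Nodup := by
  induction s using Quotient.inductionOn' with
  | _ L => exact List.Nodup.map_on h hs

/-- A successor relation on a non-empty set of matched agents contains a cyclic sequence. -/
theorem exists_pairCycle [Finite X] {L : Set (X × Y)}
    (hL : ∀ y x x', (x, y) ∈ L → (x', y) ∈ L → x = x') {D : Set X} (hD : D.Nonempty)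
    (hm : ∀ x ∈ D, ∃ y, (x, y) ∈ L) {r : X → X → Prop} (hr : ∀ x ∈ D, ∃ x' ∈ D, r x x') :
    ∃ ρ : PairCycle X Y, ρ ≠ Cycle.nil ∧ (ρ.map Prod.fst).Nodup ∧ (ρ.map Prod.snd).Nodup ∧
      (∀ p ∈ ρ, p ∈ L ∧ p.1 ∈ D) ∧ ∀ p q, Follows ρ p q → r p.1 q.1 := by
  classical
  choose m hm using hm
  choose f hfD hf using hr
  let F : D → D := fun x => ⟨f x x.2, hfD x x.2⟩
  let g : D → X × Y := fun x => (x, m x x.2)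
  obtain ⟨x₀, hx₀⟩ := hD
  -- Iterating the chosen successor map on the finite set `D` must repeat; the orbit of a periodic
  -- point is the required cycle.
  obtain ⟨a, ha⟩ : ∃ a, a ∈ Function.periodicPts F := by
    obtain ⟨i, j, hij, h⟩ := Set.finite_univ.exists_lt_map_eq_of_forall_mem
      (f := fun n : ℕ => F^[n] ⟨x₀, hx₀⟩) (fun _ => Set.mem_univ _)
    refine ⟨F^[i] ⟨x₀, hx₀⟩, j - i, by omega, ?_⟩
    change F^[j - i] (F^[i] _) = F^[i] _
    rw [← Function.iterate_add_apply, Nat.sub_add_cancel hij.le]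
    exact h.symm
  have hmem : ∀ p ∈ (Function.periodicOrbit F a).map g, ∃ x, g x = p := fun p hp => by
    obtain ⟨x, -, h⟩ := Cycle.mem_map.1 hp
    exact ⟨x, h⟩
  have hnd : ((Function.periodicOrbit F a).map g).Nodup :=
    nodup_map_of_injOn Function.nodup_periodicOrbit fun x _ x' _ h =>
      Subtype.ext (congrArg Prod.fst h)
  refine ⟨(Function.periodicOrbit F a).map g, ?_, ?_, ?_, ?_, ?_⟩
  · rw [Ne, Cycle.map_eq_nil, Function.periodicOrbit_eq_nil_iff_not_periodic_pt, not_not]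
    exact ha
  · refine nodup_map_of_injOn hnd fun p hp q hq h => ?_
    obtain ⟨x, rfl⟩ := hmem p hp
    obtain ⟨x', rfl⟩ := hmem q hq
    obtain rfl : x = x' := Subtype.ext h
    rfl
  · refine nodup_map_of_injOn hnd fun p hp q hq h => ?_
    obtain ⟨x, rfl⟩ := hmem p hp
    obtain ⟨x', rfl⟩ := hmem q hq
    have h₁ := hm x x.2
    rw [show m x x.2 = m x' x'.2 from h] at h₁
    obtain rfl : x = x' := Subtype.ext (hL _ _ _ h₁ (hm x' x'.2))
    rfl
  · intro p hp
    obtain ⟨x, rfl⟩ := hmem p hp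
    exact ⟨hm x x.2, x.2⟩
  · intro p q h
    refine h.of_chain (r := fun p q => r p.1 q.1) ?_
    rw [Cycle.chain_map, Function.periodicOrbit_chain' _ ha]
    intro n
    rw [Function.iterate_succ_apply']
    exact hf _ _

end MarriageTable

namespace MarriageTable

variable {X Y : Type*}

/-! ### Exchanging the two sides -/

/-- The table with the roles of the two sides exchanged. -/
def swap (T : MarriageTable X Y) : MarriageTable Y X where
  edges := Prod.swap ⁻¹' T.edges
  prefX := T.prefY
  prefY := T.prefX
  prefX_left := T.prefY_left
  prefX_right := T.prefY_right
  prefX_irrefl := T.prefY_irrefl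
  prefX_trans := T.prefY_trans
  prefX_total := T.prefY_total
  prefY_left := T.prefX_left
  prefY_right := T.prefX_right
  prefY_irrefl := T.prefX_irrefl
  prefY_trans := T.prefX_trans
  prefY_total := T.prefX_total

/-- The matching `M`, seen as a matching of the table with exchanged sides. -/
def swapM (M : Set (X × Y)) : Set (Y × X) := Prod.swap ⁻¹' M

variable {T : MarriageTable X Y} {M M' M'' : Set (X × Y)} {x : X} {y y' : Y}

theorem swapM_mem_matchings (h : M ∈ T.matchings) : swapM M ∈ T.swap.matchings :=
  ⟨fun _ he => h.1 he, h.2.2, h.2.1⟩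

theorem swapM_isBlockingPair (h : T.swap.IsBlockingPair (swapM M) y x) : T.IsBlockingPair M x y :=
  ⟨h.1, h.2.2, h.2.1⟩

theorem swapM_mem_stableMatchings (h : M ∈ T.stableMatchings) :
    swapM M ∈ T.swap.stableMatchings :=
  ⟨swapM_mem_matchings h.1, fun y x hb => h.2 x y (swapM_isBlockingPair hb)⟩

theorem swap_leX : T.swap.LeX (swapM M) (swapM M') ↔ T.LeY M M' :=
  ⟨fun h x y => h y x, fun h y x => h x y⟩

theorem swap_leY : T.swap.LeY (swapM M) (swapM M') ↔ T.LeX M M' :=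
  ⟨fun h x y => h y x, fun h y x => h x y⟩

/-! ### Pairs of matchings that do not block each other -/

/-- `M` and `M'` are matchings of `T` neither of which blocks the other. -/
def Compatible (T : MarriageTable X Y) (M M' : Set (X × Y)) : Prop :=
  M ∈ T.matchings ∧ M' ∈ T.matchings ∧ ¬ T.Blocks M M' ∧ ¬ T.Blocks M' M

/-- `x` strictly prefers `M` to `M'`. -/
def BetterX (T : MarriageTable X Y) (M M' : Set (X × Y)) (x : X) : Prop :=
  ∃ y, (x, y) ∈ M ∧ ∀ y', (x, y') ∈ M' → T.prefX x y y'

/-- `y` strictly prefers `M` to `M'`. -/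
def BetterY (T : MarriageTable X Y) (M M' : Set (X × Y)) (y : Y) : Prop :=
  ∃ x, (x, y) ∈ M ∧ ∀ x', (x', y) ∈ M' → T.prefY y x x'

theorem Compatible.symm (h : T.Compatible M M') : T.Compatible M' M :=
  ⟨h.2.1, h.1, h.2.2.2, h.2.2.1⟩

theorem Compatible.swap (h : T.Compatible M M') : T.swap.Compatible (swapM M) (swapM M') :=
  ⟨swapM_mem_matchings h.1, swapM_mem_matchings h.2.1,
    fun ⟨y, x, hm, hb⟩ => h.2.2.1 ⟨x, y, hm, swapM_isBlockingPair hb⟩,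
    fun ⟨y, x, hm, hb⟩ => h.2.2.2 ⟨x, y, hm, swapM_isBlockingPair hb⟩⟩

theorem compatible_of_stable (h : M ∈ T.stableMatchings) (h' : M' ∈ T.stableMatchings) :
    T.Compatible M M' :=
  ⟨h.1, h'.1, fun ⟨x, y, _, hb⟩ => h'.2 x y hb, fun ⟨x, y, _, hb⟩ => h.2 x y hb⟩

theorem not_prefX_symm (h : T.prefX x y y') : ¬ T.prefX x y' y :=
  fun h' => T.prefX_irrefl x y (T.prefX_trans _ _ _ _ h h')

theorem not_prefY_symm {x' : X} (h : T.prefY y x x') : ¬ T.prefY y x' x :=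
  fun h' => T.prefY_irrefl y x (T.prefY_trans _ _ _ _ h h')

theorem ne_of_prefX (h : T.prefX x y y') : y ≠ y' := by
  rintro rfl
  exact T.prefX_irrefl _ _ h

/-- An edge of `M` that is good for its `X`-end, compared with `M'`, is bad for its `Y`-end. -/
theorem Compatible.betterY_of_mem (h : T.Compatible M M') (hxy : (x, y) ∈ M)
    (hx : T.BetterX M M' x) : T.BetterY M' M y := by
  obtain ⟨z, hz, hx⟩ := hx
  obtain rfl := h.1.2.1 _ _ _ hxy hz
  by_contra hc
  refine h.2.2.1 ⟨x, y, hxy, h.1.1 hxy, hx, fun x' hx' => ?_⟩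
  by_cases hne : x = x'
  · subst hne
    exact absurd (hx y hx') (T.prefX_irrefl _ _)
  refine (T.prefY_total _ _ _ (h.1.1 hxy) (h.2.1.1 hx') hne).resolve_right fun hp => hc ?_
  exact ⟨x', hx', fun x'' h'' => h.1.2.2 _ _ _ hxy h'' ▸ hp⟩

theorem Compatible.betterX_of_mem (h : T.Compatible M M') (hxy : (x, y) ∈ M')
    (hy : T.BetterY M' M y) : T.BetterX M M' x :=
  h.symm.swap.betterY_of_mem (M := swapM M') (M' := swapM M) (T := T.swap) hxy hy

/-- `M` maps the agents of `X` that prefer `M` onto the agents of `Y` that prefer `M'`, and `M'`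
maps the latter onto the former. -/
theorem Compatible.surjective [Finite X] [Finite Y] (h : T.Compatible M M') :
    (∀ y, T.BetterY M' M y → ∃ x, T.BetterX M M' x ∧ (x, y) ∈ M) ∧
    (∀ x, T.BetterX M M' x → ∃ y, T.BetterY M' M y ∧ (x, y) ∈ M') := by
  -- `M` injects `A` into `B` and `M'` injects `B` into `A`; both sets are finite, so both maps are
  -- bijections.
  let A := {x // T.BetterX M M' x}
  let B := {y // T.BetterY M' M y}
  let f : A → B := fun a => ⟨a.2.choose, h.betterY_of_mem a.2.choose_spec.1 a.2⟩
  let g : B → A := fun b => ⟨b.2.choose, h.betterX_of_mem b.2.choose_spec.1 b.2⟩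
  have hf : ∀ a : A, (a.1, (f a).1) ∈ M := fun a => a.2.choose_spec.1
  have hg : ∀ b : B, ((g b).1, b.1) ∈ M' := fun b => b.2.choose_spec.1
  have fi : Function.Injective f := fun a a' e => by
    have h₁ := hf a
    rw [e] at h₁
    exact Subtype.ext (h.1.2.2 _ _ _ h₁ (hf a'))
  have gi : Function.Injective g := fun b b' e => by
    have h₁ := hg b
    rw [e] at h₁
    exact Subtype.ext (h.2.1.2.1 _ _ _ h₁ (hg b'))
  have fs : Function.Surjective f := Function.Surjective.of_comp (g := g)
    (Finite.surjective_of_injective (fi.comp gi))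
  have gs : Function.Surjective g := Function.Surjective.of_comp (g := f)
    (Finite.surjective_of_injective (gi.comp fi))
  constructor
  · intro y hy
    obtain ⟨a, ha⟩ := fs ⟨y, hy⟩
    have := hf a
    rw [ha] at this
    exact ⟨a.1, a.2, this⟩
  · intro x hx
    obtain ⟨b, hb⟩ := gs ⟨x, hx⟩
    have := hg b
    rw [hb] at this
    exact ⟨b.1, b.2, this⟩

section Finite

variable [Finite X] [Finite Y]

theorem Compatible.betterX_of_mem_left (h : T.Compatible M M') (hxy : (x, y) ∈ M)
    (hy : T.BetterY M' M y) : T.BetterX M M' x := by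
  obtain ⟨x', hx', hm⟩ := h.surjective.1 y hy
  exact h.1.2.2 _ _ _ hxy hm ▸ hx'

theorem Compatible.betterY_of_mem_right (h : T.Compatible M M') (hxy : (x, y) ∈ M')
    (hx : T.BetterX M M' x) : T.BetterY M' M y := by
  obtain ⟨y', hy', hm⟩ := h.surjective.2 x hx
  exact h.2.1.2.1 _ _ _ hxy hm ▸ hy'

/-- An `x` matched only in `M` would vacuously prefer `M`, and such agents are matched in `M'` as
well by `Compatible.surjective`. So compatible matchings cover the same agents. -/
theorem Compatible.exists_mem_right (h : T.Compatible M M') (hxy : (x, y) ∈ M) :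
    ∃ y', (x, y') ∈ M' := by
  by_contra hc
  push Not at hc
  obtain ⟨y', -, hm⟩ := h.surjective.2 x ⟨y, hxy, fun y' hy' => absurd hy' (hc y')⟩
  exact hc _ hm

theorem Compatible.exists_mem_left (h : T.Compatible M M') (hxy : (x, y) ∈ M) :
    ∃ x', (x', y) ∈ M' :=
  h.swap.exists_mem_right (T := T.swap) hxy

end Finite

/-! ### The orders on matchings -/

theorem betterX_of_prefX (hM' : M' ∈ T.matchings) (h : (x, y) ∈ M) (h' : (x, y') ∈ M')
    (hp : T.prefX x y y') : T.BetterX M M' x :=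
  ⟨y, h, fun _ h'' => hM'.2.1 _ _ _ h' h'' ▸ hp⟩

theorem betterY_of_prefY {x' : X} (hM' : M' ∈ T.matchings) (h : (x, y) ∈ M) (h' : (x', y) ∈ M')
    (hp : T.prefY y x x') : T.BetterY M M' y :=
  ⟨x, h, fun _ h'' => hM'.2.2 _ _ _ h' h'' ▸ hp⟩

theorem BetterX.prefX (hM : M ∈ T.matchings) (h : T.BetterX M M' x) (hy : (x, y) ∈ M)
    (hy' : (x, y') ∈ M') : T.prefX x y y' := by
  obtain ⟨z, hz, hp⟩ := h
  exact hM.2.1 _ _ _ hz hy ▸ hp y' hy'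

theorem BetterY.prefY {x' : X} (hM : M ∈ T.matchings) (h : T.BetterY M M' y) (hy : (x, y) ∈ M)
    (hy' : (x', y) ∈ M') : T.prefY y x x' := by
  obtain ⟨z, hz, hp⟩ := h
  exact hM.2.2 _ _ _ hz hy ▸ hp x' hy'

theorem LeX.refl (T : MarriageTable X Y) (M : Set (X × Y)) : T.LeX M M :=
  fun _ y h => ⟨y, h, Or.inl rfl⟩

theorem LeX.trans (h : T.LeX M M') (h' : T.LeX M' M'') : T.LeX M M'' := by
  intro x y hxy
  obtain ⟨a, ha, hay⟩ := h x y hxy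
  obtain ⟨b, hb, hba⟩ := h' x a ha
  refine ⟨b, hb, ?_⟩
  rcases hay with rfl | hay
  · exact hba
  · rcases hba with rfl | hba
    · exact Or.inr hay
    · exact Or.inr (T.prefX_trans _ _ _ _ hba hay)

theorem LeX.antisymm (hM : M ∈ T.matchings) (hM' : M' ∈ T.matchings) (h : T.LeX M M')
    (h' : T.LeX M' M) : M = M' := by
  have key : ∀ {M M' : Set (X × Y)}, M ∈ T.matchings → T.LeX M M' → T.LeX M' M → M ⊆ M' := by
    rintro M M' hM h h' ⟨x, y⟩ hxy
    obtain ⟨a, ha, hay⟩ := h x y hxy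
    obtain ⟨b, hb, hba⟩ := h' x a ha
    obtain rfl := hM.2.1 _ _ _ hxy hb
    rcases hay with rfl | hay
    · exact ha
    · rcases hba with rfl | hba
      · exact ha
      · exact absurd hba (not_prefX_symm hay)
  exact Set.Subset.antisymm (key hM h h') (key hM' h' h)

theorem LeX.eq_or_prefX (hM' : M' ∈ T.matchings) (h : T.LeX M M') (hy : (x, y) ∈ M)
    (hy' : (x, y') ∈ M') : y' = y ∨ T.prefX x y' y := by
  obtain ⟨z, hz, hp⟩ := h x y hy
  exact hM'.2.1 _ _ _ hz hy' ▸ hp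

section Finite

variable [Finite X] [Finite Y]

theorem Compatible.leX_of_not_betterX (h : T.Compatible M M')
    (hb : ∀ x, ¬ T.BetterX M M' x) : T.LeX M M' := by
  intro x y hxy
  obtain ⟨y', hy'⟩ := h.exists_mem_right hxy
  refine ⟨y', hy', ?_⟩
  by_cases hne : y' = y
  · exact Or.inl hne
  · refine Or.inr ((T.prefX_total _ _ _ (h.2.1.1 hy') (h.1.1 hxy) hne).resolve_right fun hp => ?_)
    exact hb x (betterX_of_prefX h.2.1 hxy hy' hp)

theorem Compatible.leY_of_leX (h : T.Compatible M M') (hle : T.LeX M M') : T.LeY M' M := by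
  intro x y hxy
  obtain ⟨y', hy'⟩ := h.symm.exists_mem_right hxy
  rcases hle.eq_or_prefX h.2.1 hy' hxy with rfl | hp
  · exact ⟨x, hy', Or.inl rfl⟩
  · obtain ⟨x', hx', hb⟩ := h.symm.betterY_of_mem hxy (betterX_of_prefX h.1 hxy hy' hp)
    exact ⟨x', hx', Or.inr (hb _ hxy)⟩

theorem Compatible.leX_of_leY (h : T.Compatible M M') (hle : T.LeY M M') : T.LeX M' M :=
  swap_leY.1 (h.swap.leY_of_leX (T := T.swap) (swap_leX.2 hle))

end Finite

/-! ### The lattice of stable matchings -/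

theorem leX_join_left (hM : M ∈ T.matchings) (hM' : M' ∈ T.matchings) :
    T.LeX M (T.join M M') := by
  intro x y hxy
  by_cases hc : ∃ y', (x, y') ∈ M' ∧ T.prefX x y' y
  · obtain ⟨y', hy', hp⟩ := hc
    exact ⟨y', ⟨Or.inr hy', fun z hz => Or.inr (hM.2.1 _ _ _ hxy hz ▸ hp),
      fun z hz => Or.inl (hM'.2.1 _ _ _ hy' hz)⟩, Or.inr hp⟩
  · push Not at hc
    refine ⟨y, ⟨Or.inl hxy, fun z hz => Or.inl (hM.2.1 _ _ _ hxy hz), fun z hz => ?_⟩, Or.inl rfl⟩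
    by_cases hne : y = z
    · exact Or.inl hne
    · exact Or.inr ((T.prefX_total _ _ _ (hM.1 hxy) (hM'.1 hz) hne).resolve_right (hc z hz))

theorem join_comm (T : MarriageTable X Y) (M M' : Set (X × Y)) : T.join M M' = T.join M' M := by
  ext e
  simp only [join, Set.mem_ofPred_eq, Set.mem_union]
  tauto

theorem leX_join_right (hM : M ∈ T.matchings) (hM' : M' ∈ T.matchings) :
    T.LeX M' (T.join M M') :=
  join_comm T M M' ▸ leX_join_left hM' hM

theorem join_leX (h : T.LeX M M'') (h' : T.LeX M' M'') : T.LeX (T.join M M') M'' := by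
  rintro x y ⟨hxy | hxy, -, -⟩
  · exact h x y hxy
  · exact h' x y hxy

/-- If `x` chose `y` from `M` and another `x'` chose `y` from `M'`, both would be strictly better
off by their choice, so `y` would prefer each of them to the other. -/
theorem Compatible.join_mem_matchings (h : T.Compatible M M') : T.join M M' ∈ T.matchings := by
  refine ⟨?_, ?_, ?_⟩
  · rintro e ⟨he | he, -, -⟩
    exacts [h.1.1 he, h.2.1.1 he]
  · rintro x y y' ⟨hy, h₁, h₂⟩ ⟨hy', h₁', h₂'⟩
    by_contra hne
    have a : T.prefX x y y' := by
      rcases hy' with hy' | hy'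
      exacts [(h₁ y' hy').resolve_left hne, (h₂ y' hy').resolve_left hne]
    have b : T.prefX x y' y := by
      rcases hy with hy | hy
      exacts [(h₁' y hy).resolve_left (Ne.symm hne), (h₂' y hy).resolve_left (Ne.symm hne)]
    exact not_prefX_symm a b
  · have key : ∀ {M M' : Set (X × Y)}, T.Compatible M M' → ∀ x x' y, (x, y) ∈ M → (x', y) ∈ M' →
        (∀ z, (x, z) ∈ M' → y = z ∨ T.prefX x y z) → (∀ z, (x', z) ∈ M → y = z ∨ T.prefX x' y z) →
        x = x' := by
      intro M M' h x x' y hx hx' h₁ h₂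
      by_contra hne
      have b₁ : T.BetterX M M' x := ⟨y, hx, fun z hz => (h₁ z hz).resolve_left (by
        rintro rfl
        exact hne (h.2.1.2.2 _ _ _ hz hx'))⟩
      have b₂ : T.BetterX M' M x' := ⟨y, hx', fun z hz => (h₂ z hz).resolve_left (by
        rintro rfl
        exact hne (h.1.2.2 _ _ _ hx hz))⟩
      exact not_prefY_symm ((h.betterY_of_mem hx b₁).prefY h.2.1 hx' hx)
        ((h.symm.betterY_of_mem hx' b₂).prefY h.1 hx hx')
    rintro y x x' ⟨hx | hx, h₁, h₂⟩ ⟨hx' | hx', h₁', h₂'⟩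
    · exact h.1.2.2 _ _ _ hx hx'
    · exact key h x x' y hx hx' h₂ h₁'
    · exact (key h x' x y hx' hx h₂' h₁).symm
    · exact h.2.1.2.2 _ _ _ hx hx'

section Finite

variable [Finite X] [Finite Y]

/-- By opposition, the join leaves `y` with the worse of its two partners. -/
theorem Compatible.exists_mem_join (h : T.Compatible M M') {a b : X} (ha : (a, y) ∈ M)
    (hb : (b, y) ∈ M') : (a, y) ∈ T.join M M' ∨ (b, y) ∈ T.join M M' := by
  have key : ∀ {M M' : Set (X × Y)}, T.Compatible M M' → ∀ {a b}, (a, y) ∈ M → (b, y) ∈ M' →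
      T.prefY y a b → (b, y) ∈ T.join M M' := by
    intro M M' h a b ha hb hp
    have hB := h.symm.betterX_of_mem_left hb (betterY_of_prefY h.2.1 ha hb hp)
    exact ⟨Or.inr hb, fun z hz => Or.inr (hB.prefX h.2.1 hb hz),
      fun z hz => Or.inl (h.2.1.2.1 _ _ _ hb hz)⟩
  by_cases hne : a = b
  · subst hne
    exact Or.inl ⟨Or.inl ha, fun z hz => Or.inl (h.1.2.1 _ _ _ ha hz),
      fun z hz => Or.inl (h.2.1.2.1 _ _ _ hb hz)⟩
  rcases T.prefY_total _ _ _ (h.1.1 ha) (h.2.1.1 hb) hne with hp | hp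
  · exact Or.inr (key h ha hb hp)
  · exact Or.inl (join_comm T M M' ▸ key h.symm hb ha hp)

/-- At the `Y`-end of a blocking pair the join agrees with `M` or with `M'`, and its `X`-end is at
least as well off in the join as in either. So the pair would already block one of the two. -/
theorem join_mem_stableMatchings (hM : M ∈ T.stableMatchings) (hM' : M' ∈ T.stableMatchings) :
    T.join M M' ∈ T.stableMatchings := by
  have h := compatible_of_stable hM hM'
  refine ⟨h.join_mem_matchings, fun x y ⟨he, hx, hy⟩ => ?_⟩
  have key : ∀ {K : Set (X × Y)}, T.LeX K (T.join M M') → ∀ z, (x, z) ∈ K → T.prefX x y z := by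
    intro K hK z hz
    obtain ⟨w, hw, hwz⟩ := hK x z hz
    rcases hwz with rfl | hwz
    exacts [hx _ hw, T.prefX_trans _ _ _ _ (hx _ hw) hwz]
  have k₁ := key (leX_join_left hM.1 hM'.1)
  have k₂ := key (leX_join_right hM.1 hM'.1)
  by_cases ha : ∃ a, (a, y) ∈ M
  · obtain ⟨a, ha⟩ := ha
    obtain ⟨b, hb⟩ := h.exists_mem_left ha
    rcases h.exists_mem_join ha hb with hj | hj
    · exact hM.2 x y ⟨he, k₁, fun x' hx' => h.1.2.2 _ _ _ ha hx' ▸ hy _ hj⟩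
    · exact hM'.2 x y ⟨he, k₂, fun x' hx' => h.2.1.2.2 _ _ _ hb hx' ▸ hy _ hj⟩
  · exact hM.2 x y ⟨he, k₁, fun x' hx' => absurd ⟨x', hx'⟩ ha⟩

/-- Two stable matchings have a meet, which pairs each `x` with the worse of its partners. -/
theorem exists_meet (hM : M ∈ T.stableMatchings) (hM' : M' ∈ T.stableMatchings) :
    ∃ K ∈ T.stableMatchings, K ⊆ M ∪ M' ∧ T.LeX K M ∧ T.LeX K M' ∧
      ∀ L ∈ T.stableMatchings, T.LeX L M → T.LeX L M' → T.LeX L K := by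
  -- The meet for `X` is the join for `Y`; opposition of interests translates the order relations.
  have hS := join_mem_stableMatchings (swapM_mem_stableMatchings hM) (swapM_mem_stableMatchings hM')
  set K : Set (X × Y) := swapM (T.swap.join (swapM M) (swapM M')) with hK
  have hKs : K ∈ T.stableMatchings := swapM_mem_stableMatchings hS
  refine ⟨K, hKs, fun e he => he.1, ?_, ?_, fun L hL h h' => ?_⟩
  · refine (compatible_of_stable hM hKs).leX_of_leY ?_
    exact swap_leX.1 (leX_join_left (swapM_mem_matchings hM.1) (swapM_mem_matchings hM'.1))
  · refine (compatible_of_stable hM' hKs).leX_of_leY ?_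
    exact swap_leX.1 (leX_join_right (swapM_mem_matchings hM.1) (swapM_mem_matchings hM'.1))
  · refine (compatible_of_stable hKs hL).leX_of_leY ?_
    exact swap_leX.1 (join_leX (swap_leX.2 ((compatible_of_stable hL hM).leY_of_leX h))
      (swap_leX.2 ((compatible_of_stable hL hM').leY_of_leX h')))

/-- A non-empty set of matchings in which any two have an upper bound has a greatest element. -/
theorem exists_greatest {S : Set (Set (X × Y))} (hS : S.Nonempty)
    (h : ∀ M ∈ S, ∀ M' ∈ S, ∃ K ∈ S, T.LeX M K ∧ T.LeX M' K) :
    ∃ K ∈ S, ∀ M ∈ S, T.LeX M K := by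
  classical
  have key : ∀ F : Set (Set (X × Y)), F.Finite → F ⊆ S → ∃ K ∈ S, ∀ M ∈ F, T.LeX M K := by
    intro F hF
    induction F, hF using Set.Finite.induction_on with
    | empty => exact fun _ => ⟨hS.some, hS.some_mem, by simp⟩
    | insert _ _ ih =>
      intro hFS
      obtain ⟨K, hK, hle⟩ := ih fun a ha => hFS (Or.inr ha)
      obtain ⟨K', hK', h₁, h₂⟩ := h _ (hFS (Or.inl rfl)) K hK
      refine ⟨K', hK', ?_⟩
      rintro M (rfl | hM)
      exacts [h₁, (hle M hM).trans h₂]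
  exact key S (Set.toFinite S) le_rfl

theorem exists_isXOptimal (h : T.stableMatchings.Nonempty) : ∃ M, T.IsXOptimal M := by
  obtain ⟨K, hK, hle⟩ := exists_greatest (T := T) h fun M hM M' hM' =>
    ⟨_, join_mem_stableMatchings hM hM', leX_join_left hM.1 hM'.1, leX_join_right hM.1 hM'.1⟩
  exact ⟨K, hK, hle⟩

theorem exists_isYOptimal (h : T.stableMatchings.Nonempty) : ∃ M, T.IsYOptimal M := by
  obtain ⟨K, hK⟩ := exists_isXOptimal (T := T.swap) (let ⟨_, hM⟩ := h; ⟨_, swapM_mem_stableMatchings hM⟩)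
  exact ⟨swapM K, swapM_mem_stableMatchings hK.1, fun M' hM' =>
    swap_leX.1 (hK.2 _ (swapM_mem_stableMatchings hM'))⟩

theorem IsYOptimal.leX (h : T.IsYOptimal M) (hM' : M' ∈ T.stableMatchings) : T.LeX M M' :=
  (compatible_of_stable hM' h.1).leX_of_leY (h.2 _ hM')

end Finite

end MarriageTable

namespace MarriageTable

variable {X Y : Type*} {T : MarriageTable X Y} {L M M' : Set (X × Y)} {ρ σ : PairCycle X Y}

/-! ### Elimination of rotations -/

/-- A cyclic sequence of edges of `M` along which each `x_i` prefers `y_i` to `y_{i+1}` and each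
`y_{i+1}` prefers `x_i` to `x_{i+1}`. -/
def IsPreRotation (T : MarriageTable X Y) (M : Set (X × Y)) (ρ : PairCycle X Y) : Prop :=
  ρ ≠ Cycle.nil ∧ (ρ.map Prod.fst).Nodup ∧ (ρ.map Prod.snd).Nodup ∧ (∀ p ∈ ρ, p ∈ M) ∧
  ∀ p q, Follows ρ p q → T.prefY q.2 p.1 q.1 ∧ T.prefX p.1 p.2 q.2

theorem Exposed.isPreRotation (h : T.Exposed M ρ) : T.IsPreRotation M ρ :=
  ⟨h.2.1, h.2.2.1, h.2.2.2.1, h.2.2.2.2.1, fun p q hpq =>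
    ⟨(h.2.2.2.2.2 p q hpq).1, (h.2.2.2.2.2 p q hpq).2.1⟩⟩

theorem exists_mem_of_ne_nil (h : ρ ≠ Cycle.nil) : ∃ p, p ∈ ρ := by
  induction ρ using Cycle.induction_on with
  | nil => exact absurd rfl h
  | cons a l _ => exact ⟨a, by simp⟩

theorem Follows.mem_eliminate {p q : X × Y} (h : Follows ρ p q) (M : Set (X × Y)) :
    (p.1, q.2) ∈ eliminate M ρ :=
  Or.inr ⟨p, q, h, rfl⟩

theorem IsPreRotation.nodup (h : T.IsPreRotation M ρ) : ρ.Nodup := nodup_of_map h.2.1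

theorem IsPreRotation.eliminate_mem_matchings (h : T.IsPreRotation M ρ) (hM : M ∈ T.matchings) :
    eliminate M ρ ∈ T.matchings := by
  refine ⟨?_, ?_, ?_⟩
  · rintro e (⟨he, -⟩ | ⟨p, q, hpq, rfl⟩)
    exacts [hM.1 he, T.prefX_right _ _ _ (h.2.2.2.2 p q hpq).2]
  · rintro x y y' (⟨he, hn⟩ | ⟨p, q, hpq, e⟩) (⟨he', hn'⟩ | ⟨p', q', hpq', e'⟩)
    · exact hM.2.1 _ _ _ he he'
    · exact absurd (congrArg Prod.fst e').symm (hn p' hpq'.mem_left)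
    · exact absurd (congrArg Prod.fst e).symm (hn' p hpq.mem_left)
    · simp only [Prod.mk.injEq] at e e'
      obtain ⟨rfl, rfl⟩ := e
      obtain rfl := eq_of_nodup_map h.2.1 hpq.mem_left hpq'.mem_left e'.1
      rw [e'.2, hpq.right_unique h.nodup hpq']
  · have key : ∀ x p q, (x, q.2) ∈ M → (∀ p ∈ ρ, p.1 ≠ x) → Follows ρ p q → False :=
      fun x p q hx hn hpq =>
        hn q hpq.mem_right (hM.2.2 _ _ _ (h.2.2.2.1 q hpq.mem_right) hx)
    rintro y x x' (⟨he, hn⟩ | ⟨p, q, hpq, e⟩) (⟨he', hn'⟩ | ⟨p', q', hpq', e'⟩)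
    · exact hM.2.2 _ _ _ he he'
    · obtain ⟨rfl, rfl⟩ := Prod.mk.inj e'
      exact (key x p' q' he hn hpq').elim
    · obtain ⟨rfl, rfl⟩ := Prod.mk.inj e
      exact (key x' p q he' hn' hpq).elim
    · simp only [Prod.mk.injEq] at e e'
      obtain ⟨rfl, rfl⟩ := e
      obtain rfl := eq_of_nodup_map h.2.2.1 hpq.mem_right hpq'.mem_right e'.2
      rw [e'.1, hpq.left_unique h.nodup hpq']

theorem IsPreRotation.eliminate_leX (h : T.IsPreRotation M ρ) : T.LeX (eliminate M ρ) M := by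
  rintro x y (⟨he, -⟩ | ⟨p, q, hpq, e⟩)
  · exact ⟨y, he, Or.inl rfl⟩
  · obtain ⟨rfl, rfl⟩ := Prod.mk.inj e
    exact ⟨p.2, h.2.2.2.1 p hpq.mem_left, Or.inr (h.2.2.2.2 p q hpq).2⟩

theorem IsPreRotation.leY_eliminate (h : T.IsPreRotation M ρ) (hM : M ∈ T.matchings) :
    T.LeY M (eliminate M ρ) := by
  intro x y hxy
  by_cases hx : ∀ p ∈ ρ, p.1 ≠ x
  · exact ⟨x, Or.inl ⟨hxy, hx⟩, Or.inl rfl⟩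
  · push Not at hx
    obtain ⟨q, hq, rfl⟩ := hx
    obtain rfl : q.2 = y := hM.2.1 _ _ _ (h.2.2.2.1 q hq) hxy
    obtain ⟨p, hp⟩ := exists_follows_left h.nodup hq
    exact ⟨p.1, hp.mem_eliminate M, Or.inr (h.2.2.2.2 p q hp).1⟩

/-- Every `y` weakly gains by the elimination, so a new blocking pair `xy` must have `x = x_i` with
`y` strictly between `y_i` and `y_{i+1}`. The last clause of exposure says that such a `y` prefers
its partner in `M`. -/
theorem Exposed.eliminate_mem_stableMatchings (h : T.Exposed M ρ) :
    eliminate M ρ ∈ T.stableMatchings := by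
  have hr := h.isPreRotation
  have hm := hr.eliminate_mem_matchings h.1.1
  refine ⟨hm, fun x y ⟨he, hx, hy⟩ => ?_⟩
  have hy' : ∀ x', (x', y) ∈ M → T.prefY y x x' := by
    intro x' hx'
    obtain ⟨z, hz, hzx⟩ := hr.leY_eliminate h.1.1 x' y hx'
    rcases hzx with rfl | hzx
    exacts [hy _ hz, T.prefY_trans _ _ _ _ (hy z hz) hzx]
  by_cases hn : ∀ p ∈ ρ, p.1 ≠ x
  · exact h.1.2 x y ⟨he, fun y' h' => hx y' (Or.inl ⟨h', hn⟩), hy'⟩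
  · push Not at hn
    obtain ⟨p, hp, rfl⟩ := hn
    obtain ⟨q, hpq⟩ := exists_follows hp
    have hpM := hr.2.2.2.1 p hp
    have hne : p.2 ≠ y := by
      rintro rfl
      exact T.prefY_irrefl _ _ (hy' p.1 hpM)
    rcases T.prefX_total _ _ _ (h.1.1.1 hpM) he hne with hlt | hlt
    · obtain ⟨z, hz, hzp⟩ := (h.2.2.2.2.2 p q hpq).2.2 y he hlt (hx _ (hpq.mem_eliminate M))
      exact not_prefY_symm hzp (hy' z hz)
    · exact h.1.2 p.1 y ⟨he, fun y' h' => h.1.1.2.1 _ _ _ hpM h' ▸ hlt, hy'⟩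

theorem Exposed.not_leX_eliminate (h : T.Exposed M ρ) : ¬ T.LeX M (eliminate M ρ) := by
  intro hle
  obtain ⟨p, hp⟩ := exists_mem_of_ne_nil h.2.1
  obtain ⟨q, hpq⟩ := exists_follows hp
  have hlt := (h.2.2.2.2.2 p q hpq).2.1
  rcases hle.eq_or_prefX h.eliminate_mem_stableMatchings.1 (h.2.2.2.2.1 p hp)
    (hpq.mem_eliminate M) with e | e
  exacts [ne_of_prefX hlt e.symm, not_prefX_symm hlt e]

theorem Exposed.rotEdges_subset (h : T.Exposed L ρ) : rotEdges ρ ⊆ T.edges := by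
  rintro e (he | ⟨p, q, hpq, rfl⟩)
  · exact h.1.1.1 (h.2.2.2.2.1 e he)
  · exact h.eliminate_mem_stableMatchings.1.1 (hpq.mem_eliminate L)

/-! ### Sequences of eliminations -/

theorem EliminatesTo.append {l l' : List (PairCycle X Y)} (h : T.EliminatesTo M l L)
    (h' : T.EliminatesTo L l' M') : T.EliminatesTo M (l ++ l') M' := by
  induction l generalizing M with
  | nil =>
    obtain rfl : L = M := h
    exact h'
  | cons σ l ih => exact ⟨h.1, ih h.2⟩

theorem EliminatesTo.split {l l' : List (PairCycle X Y)} (h : T.EliminatesTo M (l ++ l') M') :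
    ∃ L, T.EliminatesTo M l L ∧ T.EliminatesTo L l' M' := by
  induction l generalizing M with
  | nil => exact ⟨M, rfl, h⟩
  | cons σ l ih =>
    obtain ⟨L, h₁, h₂⟩ := ih h.2
    exact ⟨L, ⟨h.1, h₁⟩, h₂⟩

theorem EliminatesTo.leX {l : List (PairCycle X Y)} (h : T.EliminatesTo M l M') : T.LeX M' M := by
  induction l generalizing M with
  | nil =>
    obtain rfl : M' = M := h
    exact LeX.refl T _
  | cons σ l ih => exact (ih h.2).trans h.1.isPreRotation.eliminate_leX

theorem EliminatesTo.mem_stableMatchings {l : List (PairCycle X Y)} (hM : M ∈ T.stableMatchings)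
    (h : T.EliminatesTo M l M') : M' ∈ T.stableMatchings := by
  induction l generalizing M with
  | nil =>
    obtain rfl : M' = M := h
    exact hM
  | cons σ l ih => exact ih h.1.eliminate_mem_stableMatchings h.2

theorem EliminatesTo.exists_exposed {l : List (PairCycle X Y)} (h : T.EliminatesTo M l M')
    (hσ : σ ∈ l) : ∃ L, T.Exposed L σ ∧ T.LeX L M ∧ T.LeX M' (eliminate L σ) := by
  induction l generalizing M with
  | nil => simp at hσ
  | cons τ l ih =>
    rcases List.mem_cons.1 hσ with rfl | hσ
    · exact ⟨M, h.1, LeX.refl T M, h.2.leX⟩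
    · obtain ⟨L, h₁, h₂, h₃⟩ := ih h.2 hσ
      exact ⟨L, h₁, h₂.trans h.1.isPreRotation.eliminate_leX, h₃⟩

/-- A rotation that has been eliminated is not exposed any more. -/
theorem Exposed.not_exposed_of_leX {N : Set (X × Y)} (h : T.Exposed M σ) (hN : T.Exposed N σ) :
    ¬ T.LeX N (eliminate M σ) := by
  intro hle
  obtain ⟨p, hp⟩ := exists_mem_of_ne_nil h.2.1
  obtain ⟨q, hpq⟩ := exists_follows hp
  have hlt := (h.2.2.2.2.2 p q hpq).2.1
  rcases hle.eq_or_prefX h.eliminate_mem_stableMatchings.1 (hN.2.2.2.2.1 p hp)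
    (hpq.mem_eliminate M) with e | e
  exacts [ne_of_prefX hlt e.symm, not_prefX_symm hlt e]

theorem EliminatesTo.nodup {l : List (PairCycle X Y)} (h : T.EliminatesTo M l M') : l.Nodup := by
  induction l generalizing M with
  | nil => exact List.nodup_nil
  | cons σ l ih =>
    refine List.nodup_cons.2 ⟨fun hσ => ?_, ih h.2⟩
    obtain ⟨L, h₁, h₂, -⟩ := h.2.exists_exposed hσ
    exact h.1.not_exposed_of_leX h₁ h₂

/-- If a property of the partner of `x` is lost along a sequence of eliminations, then one of the
rotations destroys it. -/
theorem EliminatesTo.exists_crossing {l : List (PairCycle X Y)} (hM : M ∈ T.stableMatchings)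
    (h : T.EliminatesTo M l M') (P : Y → Prop) {x : X} {a b : Y} (ha : (x, a) ∈ M)
    (hb : (x, b) ∈ M') (hPa : P a) (hPb : ¬ P b) :
    ∃ τ ∈ l, ∃ p q, Follows τ p q ∧ p.1 = x ∧ P p.2 ∧ ¬ P q.2 := by
  induction l generalizing M a with
  | nil =>
    obtain rfl : M' = M := h
    exact absurd (hM.1.2.1 _ _ _ ha hb ▸ hPa) hPb
  | cons σ l ih =>
    have cont : ∀ c, (x, c) ∈ eliminate M σ → P c →
        ∃ τ ∈ σ :: l, ∃ p q, Follows τ p q ∧ p.1 = x ∧ P p.2 ∧ ¬ P q.2 := fun c hc hPc => by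
      obtain ⟨τ, hτ, h'⟩ := ih h.1.eliminate_mem_stableMatchings h.2 hc hPc
      exact ⟨τ, List.mem_cons_of_mem _ hτ, h'⟩
    by_cases hn : ∀ p ∈ σ, p.1 ≠ x
    · exact cont a (Or.inl ⟨ha, hn⟩) hPa
    · push Not at hn
      obtain ⟨p, hp, rfl⟩ := hn
      obtain ⟨q, hpq⟩ := exists_follows hp
      obtain rfl := hM.1.2.1 _ _ _ (h.1.2.2.2.2.1 p hp) ha
      by_cases hq : P q.2
      · exact cont _ (hpq.mem_eliminate M) hq
      · exact ⟨σ, by simp, p, q, hpq, rfl, hPa, hq⟩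

section Finite

variable [Finite X] [Finite Y]

/-- Below a stable matching that is not `X`-minimal there is an exposed rotation. -/
theorem exists_exposed_of_leX (hL : L ∈ T.stableMatchings) (hM : M ∈ T.stableMatchings)
    (hle : T.LeX M L) (hne : M ≠ L) : ∃ σ, T.Exposed L σ ∧ T.LeX M (eliminate L σ) := by
  have hc := compatible_of_stable hL hM
  -- Candidates for the next partner of `x`: those below its `L`-partner that would accept `x`. If
  -- `x` is worse off in `M`, its `M`-partner is one of them.
  let C : X → Set Y := fun x => {y | (x, y) ∈ T.edges ∧ (∀ a, (x, a) ∈ L → T.prefX x a y) ∧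
    ∀ x', (x', y) ∈ L → T.prefY y x x'}
  have hCM : ∀ x m, T.BetterX L M x → (x, m) ∈ M → m ∈ C x := fun x m hx hm =>
    ⟨hM.1.1 hm, fun a ha => hx.prefX hL.1 ha hm,
      fun x' hx' => (hc.betterY_of_mem_right hm hx).prefY hM.1 hm hx'⟩
  have hD : {x | T.BetterX L M x}.Nonempty := by
    by_contra hD
    rw [Set.not_nonempty_iff_eq_empty, Set.eq_empty_iff_forall_notMem] at hD
    exact hne (hle.antisymm hM.1 hL.1 (hc.leX_of_not_betterX hD))
  obtain ⟨ρ, h₀, h₁, h₂, h₃, h₄⟩ := exists_pairCycle (L := L) hL.1.2.2 hD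
    (fun x ⟨y, hy, _⟩ => ⟨y, hy⟩)
    (r := fun x x' => ∃ y ∈ C x, (∀ z ∈ C x, ¬ T.prefX x z y) ∧ (x', y) ∈ L) (by
      intro x hx
      obtain ⟨a, ha, -⟩ := id hx
      obtain ⟨m, hm⟩ := hc.exists_mem_right ha
      have : IsTrans Y (T.prefX x) := ⟨T.prefX_trans x⟩
      have : Std.Irrefl (T.prefX x) := ⟨T.prefX_irrefl x⟩
      obtain ⟨y, hy, hmin⟩ := (Finite.wellFounded_of_trans_of_irrefl (T.prefX x)).has_min (C x)
        ⟨m, hCM x m hx hm⟩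
      -- If `y` is not the `M`-partner of `x`, then `x` prefers it to that partner, so stability of
      -- `M` gives `y` someone better than `x`. Hence the `L`-partner of `y` is again worse off in
      -- `M`, and the succession stays inside the chosen set.
      have hB : T.BetterY M L y := by
        by_cases hmy : m = y
        · subst hmy
          exact ⟨x, hm, hy.2.2⟩
        have hp : T.prefX x y m := (T.prefX_total _ _ _ (hM.1.1 hm) hy.1 hmy).resolve_left
          (hmin m (hCM x m hx hm))
        by_contra hB
        refine hM.2 x y ⟨hy.1, fun y' hy' => hM.1.2.1 _ _ _ hm hy' ▸ hp, fun x' hx' => ?_⟩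
        have hxx : x ≠ x' := by
          rintro rfl
          exact hmy (hM.1.2.1 _ _ _ hm hx')
        refine (T.prefY_total _ _ _ hy.1 (hM.1.1 hx') hxx).resolve_right fun hp' => hB ?_
        exact ⟨x', hx', fun z hz => T.prefY_trans _ _ _ _ hp' (hy.2.2 z hz)⟩
      obtain ⟨w, hw, -⟩ := id hB
      obtain ⟨x', hx'⟩ := hc.symm.exists_mem_left hw
      exact ⟨x', hc.betterX_of_mem_left hx' hB, y, hy, hmin, hx'⟩)
  have hstep : ∀ p q, Follows ρ p q → q.2 ∈ C p.1 ∧ ∀ z ∈ C p.1, ¬ T.prefX p.1 z q.2 := by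
    intro p q hpq
    obtain ⟨y, hy, hmin, hq⟩ := h₄ p q hpq
    obtain rfl := hL.1.2.1 _ _ _ (h₃ q hpq.mem_right).1 hq
    exact ⟨hy, hmin⟩
  refine ⟨ρ, ⟨hL, h₀, h₁, h₂, fun p hp => (h₃ p hp).1, fun p q hpq => ?_⟩, ?_⟩
  · have hpL := (h₃ p hpq.mem_left).1
    refine ⟨(hstep p q hpq).1.2.2 _ (h₃ q hpq.mem_right).1, (hstep p q hpq).1.2.1 _ hpL, ?_⟩
    intro y hy hpy hyq
    by_contra hcon
    push Not at hcon
    refine (hstep p q hpq).2 y ⟨hy, fun a ha => hL.1.2.1 _ _ _ hpL ha ▸ hpy, fun x' hx' => ?_⟩ hyq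
    refine (T.prefY_total _ _ _ hy (hL.1.1 hx') ?_).resolve_right (hcon x' hx')
    rintro rfl
    exact ne_of_prefX hpy (hL.1.2.1 _ _ _ hpL hx')
  · intro x m hm
    by_cases hn : ∀ p ∈ ρ, p.1 ≠ x
    · obtain ⟨a, ha, ham⟩ := hle x m hm
      exact ⟨a, Or.inl ⟨ha, hn⟩, ham⟩
    · push Not at hn
      obtain ⟨p, hp, rfl⟩ := hn
      obtain ⟨q, hpq⟩ := exists_follows hp
      refine ⟨q.2, hpq.mem_eliminate L, ?_⟩
      have hmC := hCM p.1 m (h₃ p hp).2 hm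
      by_cases hqm : q.2 = m
      · exact Or.inl hqm
      · exact Or.inr ((T.prefX_total _ _ _ (hstep p q hpq).1.1 hmC.1 hqm).resolve_right
          ((hstep p q hpq).2 m hmC))

theorem exists_eliminatesTo (hL : L ∈ T.stableMatchings) (hM : M ∈ T.stableMatchings)
    (hle : T.LeX M L) : ∃ l, T.EliminatesTo L l M := by
  let r : Set (X × Y) → Set (X × Y) → Prop := fun K K' => T.LeX K K' ∧ ¬ T.LeX K' K
  have : IsTrans _ r := ⟨fun _ _ _ h h' => ⟨h.1.trans h'.1, fun hc => h.2 (h'.1.trans hc)⟩⟩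
  have : Std.Irrefl r := ⟨fun _ h => h.2 h.1⟩
  induction L using (Finite.wellFounded_of_trans_of_irrefl r).induction with
  | _ L ih =>
    by_cases hne : M = L
    · exact ⟨[], hne⟩
    obtain ⟨σ, hσ, h⟩ := exists_exposed_of_leX hL hM hle hne
    obtain ⟨l, hl⟩ := ih _ ⟨hσ.isPreRotation.eliminate_leX, hσ.not_leX_eliminate⟩
      hσ.eliminate_mem_stableMatchings h
    exact ⟨σ :: l, hσ, hl⟩

/-! ### Rotations of stable tables -/

variable {N : Set (X × Y)} {p q : X × Y}

/-- In the list of `x_i` there is nothing between `y_i` and `y_{i+1}`. -/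
theorem IsStableTable.not_between_left (hT : T.IsStableTable) (h : T.Exposed L ρ)
    (hpq : Follows ρ p q) {y : Y} (h₁ : T.prefX p.1 p.2 y) : ¬ T.prefX p.1 y q.2 := by
  intro h₂
  have he := T.prefX_left _ _ _ h₂
  -- In a stable matching `N` through the intermediate edge, `x_i` is worse off than in `L`, so `y`
  -- must be better off. Exposure says the opposite.
  obtain ⟨N, hN, hyN⟩ := hT _ he
  obtain ⟨x, hx, hp⟩ := (h.2.2.2.2.2 p q hpq).2.2 y he h₁ h₂
  have hpL := h.2.2.2.2.1 p hpq.mem_left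
  have := (compatible_of_stable h.1 hN).betterY_of_mem_right hyN
    (betterX_of_prefX hN.1 hpL hyN h₁)
  exact not_prefY_symm hp (this.prefY hN.1 hyN hx)

theorem IsStableTable.eq_or_prefX (hT : T.IsStableTable) (h : T.Exposed L ρ)
    (hpq : Follows ρ p q) {y : Y} (h₁ : T.prefX p.1 p.2 y) : q.2 = y ∨ T.prefX p.1 q.2 y := by
  by_cases hne : q.2 = y
  · exact Or.inl hne
  · exact Or.inr ((T.prefX_total _ _ _ (h.rotEdges_subset (Or.inr ⟨p, q, hpq, rfl⟩))
      (T.prefX_right _ _ _ h₁) hne).resolve_right (hT.not_between_left h hpq h₁))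

/-- Since there is no gap below `y_i`, the partner of `x_i` in `N` is `y_{i+1}` or worse. In the
latter case stability of `N` gives `y_{i+1}` a partner at least as good as `x_i`. -/
theorem IsStableTable.exists_mem_right (hT : T.IsStableTable) (h : T.Exposed L ρ)
    (hN : N ∈ T.stableMatchings) (hpq : Follows ρ p q) (hb : T.BetterX L N p.1) :
    ∃ x, (x, q.2) ∈ N ∧ (x = p.1 ∨ T.prefY q.2 x p.1) := by
  have hpL := h.2.2.2.2.1 p hpq.mem_left
  obtain ⟨n, hn⟩ := (compatible_of_stable h.1 hN).exists_mem_right hpL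
  rcases hT.eq_or_prefX h hpq (hb.prefX h.1.1 hpL hn) with rfl | hp
  · exact ⟨_, hn, Or.inl rfl⟩
  · by_contra hcon
    push Not at hcon
    have he : (p.1, q.2) ∈ T.edges := h.rotEdges_subset (Or.inr ⟨p, q, hpq, rfl⟩)
    refine hN.2 p.1 q.2 ⟨he, fun y' hy' => hN.1.2.1 _ _ _ hn hy' ▸ hp, fun x' hx' => ?_⟩
    exact (T.prefY_total _ _ _ he (hN.1.1 hx') (hcon x' hx').1.symm).resolve_right
      (hcon x' hx').2

/-- If one agent `x_i` of a rotation is worse off in the stable matching `N`, then the whole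
rotation has been eliminated on the way to `N`. -/
theorem IsStableTable.forall_betterX (hT : T.IsStableTable) (h : T.Exposed L ρ)
    (hN : N ∈ T.stableMatchings) (hp : p ∈ ρ) (hb : T.BetterX L N p.1) :
    ∀ q ∈ ρ, T.BetterX L N q.1 := by
  -- Losses spread along the cycle: `y_{i+1}` gets at least `x_i` in `N`, hence gains over
  -- `x_{i+1}`, and so `x_{i+1}` loses.
  refine forall_mem_of_follows (P := fun q => T.BetterX L N q.1) (fun a b hab ha => ?_) hp hb
  obtain ⟨x, hx, hxa⟩ := hT.exists_mem_right h hN hab ha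
  have hlt := (h.2.2.2.2.2 a b hab).1
  have hbL := h.2.2.2.2.1 b hab.mem_right
  refine (compatible_of_stable h.1 hN).betterX_of_mem_left hbL (betterY_of_prefY h.1.1 hx hbL ?_)
  rcases hxa with rfl | hxa
  exacts [hlt, T.prefY_trans _ _ _ _ hxa hlt]

/-- In the list of `y_{i+1}` there is nothing between `x_i` and `x_{i+1}`. -/
theorem IsStableTable.not_between_right (hT : T.IsStableTable) (h : T.Exposed L ρ)
    (hpq : Follows ρ p q) {x : X} (h₁ : T.prefY q.2 p.1 x) : ¬ T.prefY q.2 x q.1 := by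
  intro h₂
  obtain ⟨N, hN, hxN⟩ := hT _ (T.prefY_left _ _ _ h₂)
  have hqL := h.2.2.2.2.1 q hpq.mem_right
  have hb := (compatible_of_stable h.1 hN).betterX_of_mem_left hqL
    (betterY_of_prefY h.1.1 hxN hqL h₂)
  obtain ⟨z, hz, hzp⟩ := hT.exists_mem_right h hN hpq
    (hT.forall_betterX h hN hpq.mem_right hb p hpq.mem_left)
  obtain rfl := hN.1.2.2 _ _ _ hz hxN
  rcases hzp with rfl | hzp
  exacts [T.prefY_irrefl _ _ h₁, not_prefY_symm h₁ hzp]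

/-- Different rotations of a stable table have no pair in common. -/
theorem IsStableTable.eq_of_mem (hT : T.IsStableTable) (hρ : ρ ∈ T.rotations)
    (hσ : σ ∈ T.rotations) (hpρ : p ∈ ρ) (hpσ : p ∈ σ) : ρ = σ := by
  obtain ⟨L, hL⟩ := hρ
  obtain ⟨M, hM⟩ := hσ
  refine eq_of_follows hL.isPreRotation.nodup hM.isPreRotation.nodup hpρ hpσ ?_
    fun a ha => T.prefX_irrefl _ _ (hL.2.2.2.2.2 a a ha).2.1
  intro a b c hab hac
  have eb := hL.2.2.2.2.2 a b hab
  have ec := hM.2.2.2.2.2 a c hac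
  -- The absence of gaps fixes the successor of a pair: first its `Y`-entry as the next entry in the
  -- list of `a.1`, then its `X`-entry as the next after `a.1` in the list of that agent.
  have h₂ : b.2 = c.2 := by
    rcases hT.eq_or_prefX hL hab ec.2.1 with e | e
    exacts [e, absurd e (hT.not_between_left hM hac eb.2.1)]
  have h₁ : b.1 = c.1 := by
    by_contra hne
    rcases T.prefY_total _ _ _ (T.prefY_right _ _ _ eb.1) (h₂ ▸ T.prefY_right _ _ _ ec.1) hne
      with e | e
    · exact hT.not_between_right hM hac (h₂ ▸ eb.1) (h₂ ▸ e)
    · exact hT.not_between_right hL hab (h₂ ▸ ec.1) e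
  exact Prod.ext h₁ h₂

/-- In a stable table the betweenness clause is vacuous, so exposure depends only on the matching
containing the pairs of the rotation. -/
theorem IsStableTable.exposed_of_subset (hT : T.IsStableTable) (h : T.Exposed L ρ)
    (hM : M ∈ T.stableMatchings) (hρ : ∀ p ∈ ρ, p ∈ M) : T.Exposed M ρ :=
  ⟨hM, h.2.1, h.2.2.1, h.2.2.2.1, hρ, fun p q hpq =>
    ⟨(h.2.2.2.2.2 p q hpq).1, (h.2.2.2.2.2 p q hpq).2.1, fun _ _ h₁ h₂ =>
      absurd h₂ (hT.not_between_left h hpq h₁)⟩⟩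

/-- Every rotation is met on the way from the `X`-optimal to the `Y`-optimal stable matching. -/
theorem IsStableTable.mem_of_eliminatesTo (hT : T.IsStableTable) (hσ : σ ∈ T.rotations)
    {MX MY : Set (X × Y)} (hX : T.IsXOptimal MX) (hY : T.IsYOptimal MY)
    {l : List (PairCycle X Y)} (hl : T.EliminatesTo MX l MY) : σ ∈ l := by
  obtain ⟨L, hL⟩ := id hσ
  obtain ⟨p, hp⟩ := exists_mem_of_ne_nil hL.2.1
  obtain ⟨q, hpq⟩ := exists_follows hp
  have hpL := hL.2.2.2.2.1 p hp
  have hlt := (hL.2.2.2.2.2 p q hpq).2.1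
  have hE := hL.eliminate_mem_stableMatchings
  obtain ⟨a, ha, hap⟩ := hX.2 L hL.1 _ _ hpL
  obtain ⟨b, hb⟩ := (compatible_of_stable hX.1 hY.1).exists_mem_right ha
  have hbp : T.prefX p.1 p.2 b := by
    rcases (hY.leX hE).eq_or_prefX hE.1 hb (hpq.mem_eliminate L) with e | e
    exacts [e ▸ hlt, T.prefX_trans _ _ _ _ hlt e]
  -- Some `τ` takes `p.1` from `p.2` or better to something below `p.2`. Without gaps it must start
  -- at `p.2` itself, so it shares `p` with `σ`.
  obtain ⟨τ, hτ, p', q', hpq', hx, hP, hnP⟩ := hl.exists_crossing hX.1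
    (fun y => y = p.2 ∨ T.prefX p.1 y p.2) ha hb hap (by
      rintro (rfl | h)
      exacts [T.prefX_irrefl _ _ hbp, not_prefX_symm hbp h])
  obtain ⟨K, hK, -, -⟩ := hl.exists_exposed hτ
  push Not at hnP
  have hq' : T.prefX p.1 p.2 q'.2 :=
    (T.prefX_total _ _ _ (hL.1.1.1 hpL) (hx ▸ hK.rotEdges_subset (Or.inr ⟨p', q', hpq', rfl⟩))
      hnP.1.symm).resolve_right hnP.2
  have hpp : p' = p := by
    refine Prod.ext hx (hP.resolve_right fun h => ?_)
    exact hT.not_between_left hK hpq' (hx ▸ h) (hx ▸ hq')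
  exact hT.eq_of_mem hσ ⟨K, hK⟩ hp (hpp ▸ hpq'.mem_left) ▸ hτ

/-- The strict predecessors of a rotation can be eliminated from the `X`-optimal stable matching,
and then the rotation is exposed. -/
theorem IsStableTable.exists_eliminatesSetTo (hT : T.IsStableTable) (hρ : ρ ∈ T.rotations)
    {MX MY : Set (X × Y)} (hX : T.IsXOptimal MX) (hY : T.IsYOptimal MY) :
    ∃ M₀, T.EliminatesSetTo MX (T.rotPredecessors ρ) M₀ ∧ T.Exposed M₀ ρ := by
  obtain ⟨L, hL⟩ := id hρ
  -- `M₀` is the greatest stable matching containing all pairs of `ρ`; it exists because this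
  -- property is preserved by joins.
  obtain ⟨M₀, ⟨hM₀, hρM₀⟩, hmax⟩ := exists_greatest (T := T)
    (S := {M | M ∈ T.stableMatchings ∧ ∀ p ∈ ρ, p ∈ M}) ⟨L, hL.1, hL.2.2.2.2.1⟩ (by
      rintro M ⟨hM, h⟩ M' ⟨hM', h'⟩
      refine ⟨_, ⟨join_mem_stableMatchings hM hM', fun p hp => ?_⟩, leX_join_left hM.1 hM'.1,
        leX_join_right hM.1 hM'.1⟩
      exact ⟨Or.inl (h p hp), fun y hy => Or.inl (hM.1.2.1 _ _ _ (h p hp) hy),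
        fun y hy => Or.inl (hM'.1.2.1 _ _ _ (h' p hp) hy)⟩)
  have hex := hT.exposed_of_subset hL hM₀ hρM₀
  obtain ⟨l, hl⟩ := exists_eliminatesTo hX.1 hM₀ (hX.2 _ hM₀)
  have hE := hex.eliminate_mem_stableMatchings
  obtain ⟨l', hl'⟩ := exists_eliminatesTo hE hY.1 (hY.leX hE)
  have hfull : T.EliminatesTo MX (l ++ ρ :: l') MY := hl.append ⟨hex, hl'⟩
  have hnd := hfull.nodup
  have hρl : ρ ∉ l ∧ ρ ∉ l' := by
    rw [List.nodup_append, List.nodup_cons] at hnd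
    exact ⟨fun h => hnd.2.2 ρ h ρ (by simp) rfl, hnd.2.1.1⟩
  refine ⟨M₀, ⟨l, hl.nodup, ?_, hl⟩, hex⟩
  ext σ
  constructor
  · intro hσ
    obtain ⟨K, hK, -, hK'⟩ := hl.exists_exposed (show σ ∈ l from hσ)
    refine ⟨⟨K, hK⟩, fun e => hρl.1 (e ▸ hσ), ?_⟩
    intro M M' l₁ _ hM hσl hρl₁
    obtain ⟨a, b, rfl⟩ := List.append_of_mem hρl₁
    obtain ⟨L', ha, hb⟩ := hM.split
    have hσa : σ ∈ a := by
      rcases List.mem_append.1 hσl with h | h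
      · exact h
      rcases List.mem_cons.1 h with h | h
      · exact absurd (h ▸ hσ) hρl.1
      -- If `σ` came after `ρ`, it would be exposed in some `W` below `L'`. But `L'` contains `ρ`,
      -- so it is below `M₀`, which is reached only after `σ` has been eliminated.
      · obtain ⟨W, hW, hWL, -⟩ := hb.2.exists_exposed h
        refine absurd ?_ (hK.not_exposed_of_leX hW)
        refine (hWL.trans hb.1.isPreRotation.eliminate_leX).trans (LeX.trans ?_ hK')
        exact hmax L' ⟨hb.1.1, hb.1.2.2.2.2.1⟩
    exact (List.singleton_sublist.2 hσa).append (List.singleton_sublist.2 (by simp))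
  · rintro ⟨hσ, hne, hprec⟩
    -- Every rotation occurs on the full chain through `M₀`, and a predecessor must occur there
    -- before `ρ`, that is, in `l`.
    have hσf := hT.mem_of_eliminatesTo hσ hX hY hfull
    have hsub := hprec _ _ _ hX hfull hσf (by simp)
    by_contra hσl
    have hσl : σ ∉ l := hσl
    rw [List.sublist_append_iff] at hsub
    obtain ⟨s, t, hst, hs, ht⟩ := hsub
    cases s with
    | nil =>
      obtain rfl : [σ, ρ] = t := hst
      rcases List.sublist_cons_iff.1 ht with h | ⟨r, hr, -⟩
      · exact hρl.2 (h.subset (by simp))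
      · exact hne (List.cons.inj hr).1
    | cons c s =>
      obtain rfl : σ = c := (List.cons.inj hst).1
      exact hσl (hs.subset (by simp))

end Finite

end MarriageTable

namespace MarriageTable

variable {X Y : Type*} {T T' T₁ T₂ : MarriageTable X Y} {M M' : Set (X × Y)}
  {ρ σ : PairCycle X Y}

/-! ### Subtables -/

theorem IsSubtable.prefX (h : T₁.IsSubtable T₂) {x : X} {y y' : Y} (hp : T₁.prefX x y y') :
    T₂.prefX x y y' :=
  (h.2.1 x y y' (T₁.prefX_left _ _ _ hp) (T₁.prefX_right _ _ _ hp)).1 hp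

theorem IsSubtable.prefY (h : T₁.IsSubtable T₂) {x x' : X} {y : Y} (hp : T₁.prefY y x x') :
    T₂.prefY y x x' :=
  (h.2.2 y x x' (T₁.prefY_left _ _ _ hp) (T₁.prefY_right _ _ _ hp)).1 hp

theorem isSubtable_of_subset (h₁ : T₁.IsSubtable T) (h₂ : T₂.IsSubtable T)
    (h : T₁.edges ⊆ T₂.edges) : T₁.IsSubtable T₂ :=
  ⟨h, fun x y y' hy hy' => (h₁.2.1 x y y' hy hy').trans (h₂.2.1 x y y' (h hy) (h hy')).symm,
    fun y x x' hx hx' => (h₁.2.2 y x x' hx hx').trans (h₂.2.2 y x x' (h hx) (h hx')).symm⟩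

theorem restrict_isSubtable (T : MarriageTable X Y) (E : Set (X × Y)) :
    (T.restrict E).IsSubtable T :=
  ⟨fun _ h => h.1, fun _ _ _ h h' => ⟨fun k => k.2.2, fun k => ⟨h.2, h'.2, k⟩⟩,
    fun _ _ _ h h' => ⟨fun k => k.2.2, fun k => ⟨h.2, h'.2, k⟩⟩⟩

theorem IsSubtable.matchings_subset (h : T₁.IsSubtable T₂) (hM : M ∈ T₁.matchings) :
    M ∈ T₂.matchings :=
  ⟨hM.1.trans h.1, hM.2⟩

theorem IsSubtable.isBlockingPair_iff (h : T₁.IsSubtable T₂) (hM : M ⊆ T₁.edges) {x : X} {y : Y}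
    (hxy : (x, y) ∈ T₁.edges) : T₁.IsBlockingPair M x y ↔ T₂.IsBlockingPair M x y :=
  ⟨fun hb => ⟨h.1 hxy, fun y' hy' => h.prefX (hb.2.1 y' hy'), fun x' hx' => h.prefY (hb.2.2 x' hx')⟩,
    fun hb => ⟨hxy, fun y' hy' => (h.2.1 _ _ _ hxy (hM hy')).2 (hb.2.1 y' hy'),
      fun x' hx' => (h.2.2 _ _ _ hxy (hM hx')).2 (hb.2.2 x' hx')⟩⟩

theorem IsSubtable.mem_stableMatchings_iff (h : T₁.IsSubtable T₂) :
    M ∈ T₁.stableMatchings ↔ M ∈ T₂.matchings ∧ M ⊆ T₁.edges ∧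
      ∀ x y, (x, y) ∈ T₁.edges → ¬ T₂.IsBlockingPair M x y :=
  ⟨fun hM => ⟨h.matchings_subset hM.1, hM.1.1, fun x y hxy hb =>
      hM.2 x y ((h.isBlockingPair_iff hM.1.1 hxy).2 hb)⟩,
    fun hM => ⟨⟨hM.2.1, hM.1.2⟩, fun x y hb =>
      hM.2.2 x y hb.1 ((h.isBlockingPair_iff hM.2.1 hb.1).1 hb)⟩⟩

theorem IsSubtable.mem_stableMatchings_of_subset (h : T₁.IsSubtable T₂)
    (hM : M ∈ T₂.stableMatchings) (hs : M ⊆ T₁.edges) : M ∈ T₁.stableMatchings :=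
  h.mem_stableMatchings_iff.2 ⟨hM.1, hs, fun x y _ => hM.2 x y⟩

theorem IsSubtable.compatible (h : T₁.IsSubtable T₂) (hM : M ∈ T₁.stableMatchings)
    (hM' : M' ∈ T₁.stableMatchings) : T₂.Compatible M M' :=
  ⟨h.matchings_subset hM.1, h.matchings_subset hM'.1,
    fun ⟨x, y, hxy, hb⟩ => (h.mem_stableMatchings_iff.1 hM').2.2 x y (hM.1.1 hxy) hb,
    fun ⟨x, y, hxy, hb⟩ => (h.mem_stableMatchings_iff.1 hM).2.2 x y (hM'.1.1 hxy) hb⟩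

theorem IsSubtable.leX (h : T₁.IsSubtable T₂) (hle : T₁.LeX M M') : T₂.LeX M M' := fun x y hxy =>
  let ⟨y', hy', hp⟩ := hle x y hxy
  ⟨y', hy', hp.imp_right h.prefX⟩

theorem IsSubtable.leY (h : T₁.IsSubtable T₂) (hle : T₁.LeY M M') : T₂.LeY M M' := fun x y hxy =>
  let ⟨x', hx', hp⟩ := hle x y hxy
  ⟨x', hx', hp.imp_right h.prefY⟩

theorem IsSubtable.join_eq (h : T₁.IsSubtable T₂) (hM : M ⊆ T₁.edges) (hM' : M' ⊆ T₁.edges) :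
    T₁.join M M' = T₂.join M M' := by
  have hU : ∀ e ∈ M ∪ M', e ∈ T₁.edges := fun e he => he.elim (fun h => hM h) (fun h => hM' h)
  ext ⟨x, y⟩
  refine and_congr_right fun he => and_congr ?_ ?_
  · exact forall₂_congr fun y' hy' => or_congr_right (h.2.1 x y y' (hU _ he) (hM hy'))
  · exact forall₂_congr fun y' hy' => or_congr_right (h.2.1 x y y' (hU _ he) (hM' hy'))

/-- Passing to a subtable only removes intermediate edges from the last clause of exposure; what
must survive is `M` and the new edges of the rotation. -/
theorem IsSubtable.exposed (h : T₁.IsSubtable T₂) (he : T₂.Exposed M σ)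
    (hM : M ∈ T₁.stableMatchings) (hσ : shiftEdges σ ⊆ T₁.edges) : T₁.Exposed M σ := by
  refine ⟨hM, he.2.1, he.2.2.1, he.2.2.2.1, he.2.2.2.2.1, fun p q hpq => ?_⟩
  have hp := hM.1.1 (he.2.2.2.2.1 p hpq.mem_left)
  have hq := hM.1.1 (he.2.2.2.2.1 q hpq.mem_right)
  have hs : (p.1, q.2) ∈ T₁.edges := hσ ⟨p, q, hpq, rfl⟩
  obtain ⟨h₁, h₂, h₃⟩ := he.2.2.2.2.2 p q hpq
  refine ⟨(h.2.2 _ _ _ hs hq).2 h₁, (h.2.1 _ _ _ hp hs).2 h₂, fun y hy hpy hyq => ?_⟩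
  obtain ⟨x, hx, hxp⟩ := h₃ y (h.1 hy) (h.prefX hpy) (h.prefX hyq)
  exact ⟨x, hx, (h.2.2 _ _ _ (hM.1.1 hx) hy).2 hxp⟩

theorem IsSubtable.eliminatesTo (h : T₁.IsSubtable T₂) {l : List (PairCycle X Y)}
    (hl : T₂.EliminatesTo M l M') (hM : M ∈ T₁.stableMatchings)
    (hσ : ∀ σ ∈ l, shiftEdges σ ⊆ T₁.edges) : T₁.EliminatesTo M l M' := by
  induction l generalizing M with
  | nil => exact hl
  | cons σ l ih =>
    have he := h.exposed hl.1 hM (hσ σ (by simp))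
    exact ⟨he, ih hl.2 he.eliminate_mem_stableMatchings fun τ hτ =>
      hσ τ (List.mem_cons_of_mem _ hτ)⟩

/-! ### Internally stable sets and their tables -/

theorem InternallyStable.compatible {N : Set (Set (X × Y))} (h : T.InternallyStable N)
    (hN : N ⊆ T.matchings) (hM : M ∈ N) (hM' : M' ∈ N) : T.Compatible M M' :=
  ⟨hN hM, hN hM', (h M hM M' hM').1, (h M hM M' hM').2⟩

theorem not_blocks_self (T : MarriageTable X Y) (M : Set (X × Y)) : ¬ T.Blocks M M :=
  fun ⟨_, y, hxy, hb⟩ => T.prefX_irrefl _ _ (hb.2.1 y hxy)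

theorem mem_internalClosure_iff {N : Set (Set (X × Y))} (h : T.InternallyStable N)
    (hN : N ⊆ T.matchings) :
    M ∈ T.internalClosure N ↔ M ∈ T.matchings ∧ ∀ K ∈ N, T.Compatible M K := by
  constructor
  · rintro ⟨hM, hs⟩
    exact ⟨hM, fun K hK => ⟨hM, hN hK, hs M (Or.inl rfl) K (Or.inr hK)⟩⟩
  · rintro ⟨hM, hs⟩
    refine ⟨hM, ?_⟩
    rintro A (rfl | hA) B (rfl | hB)
    · exact ⟨not_blocks_self T _, not_blocks_self T _⟩
    · exact (hs B hB).2.2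
    · exact (hs A hA).symm.2.2
    · exact h A hA B hB

theorem internallyClosed_iff {N : Set (Set (X × Y))} (hN : N ⊆ T.matchings) :
    T.InternallyClosed N ↔ T.InternallyStable N ∧
      ∀ M ∈ T.matchings, (∀ K ∈ N, T.Compatible M K) → M ∈ N := by
  refine and_congr_right fun h => ?_
  constructor
  · intro he M hM hc
    rw [← he]
    exact (mem_internalClosure_iff h hN).2 ⟨hM, hc⟩
  · intro hc
    refine Set.Subset.antisymm (fun M hM => ?_) fun M hM => ?_
    · have := (mem_internalClosure_iff h hN).1 hM
      exact hc M this.1 this.2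
    · exact (mem_internalClosure_iff h hN).2 ⟨hN hM, fun K hK => h.compatible hN hM hK⟩

/-- Every edge of the restricted table belongs to a member of `N`, so a blocking pair would make
that member block `M`. -/
theorem InternallyStable.mem_stableMatchings {N : Set (Set (X × Y))} (h : T.InternallyStable N)
    (hN : N ⊆ T.matchings) (hM : M ∈ N) : M ∈ (T.restrict (⋃₀ N)).stableMatchings := by
  refine (restrict_isSubtable T _).mem_stableMatchings_iff.2
    ⟨hN hM, fun e he => ⟨(hN hM).1 he, M, hM, he⟩, ?_⟩
  rintro x y ⟨-, K, hK, hxy⟩ hb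
  exact (h M hM K hK).2 ⟨x, y, hxy, hb⟩

theorem InternallyStable.isStableTable {N : Set (Set (X × Y))} (h : T.InternallyStable N)
    (hN : N ⊆ T.matchings) : (T.restrict (⋃₀ N)).IsStableTable := by
  rintro e ⟨-, M, hM, he⟩
  exact ⟨M, h.mem_stableMatchings hN hM, he⟩

theorem InternallyClosed.eq_stableMatchings {N : Set (Set (X × Y))} (h : T.InternallyClosed N)
    (hN : N ⊆ T.matchings) : N = (T.restrict (⋃₀ N)).stableMatchings := by
  obtain ⟨hs, hc⟩ := (internallyClosed_iff hN).1 h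
  refine Set.Subset.antisymm (fun M hM => hs.mem_stableMatchings hN hM) fun M hM => ?_
  have hsub := restrict_isSubtable T (⋃₀ N)
  exact hc M (hsub.matchings_subset hM.1) fun K hK =>
    hsub.compatible hM (hs.mem_stableMatchings hN hK)

/-- The closure of the empty family contains the empty matching. -/
theorem InternallyClosed.nonempty {N : Set (Set (X × Y))} (h : T.InternallyClosed N)
    (hN : N ⊆ T.matchings) : N.Nonempty := by
  by_contra hne
  rw [Set.not_nonempty_iff_eq_empty] at hne
  have := ((internallyClosed_iff hN).1 h).2 ∅ ⟨by simp, by simp, by simp⟩ (by simp [hne])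
  simp [hne] at this

/-! ### Internal closedness and maximality under join and opposition -/

/-- If an edge `xy` of `M` blocks `M'`, it belongs to the join. The join is above `M'` for `X`, so
opposition makes `y` weakly prefer its partner in `M'` to `x`, a contradiction. -/
theorem internallyStable_of_joinClosed {N : Set (Set (X × Y))} (hN : N ⊆ T.matchings)
    (hj : T.JoinClosed N) (ho : T.OppositionOfInterests N) : T.InternallyStable N := by
  have key : ∀ M ∈ N, ∀ M' ∈ N, ¬ T.Blocks M M' := by
    rintro M hM M' hM' ⟨x, y, hxy, he, hx, hy⟩
    have hJ := hj M hM M' hM'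
    have hxJ : (x, y) ∈ T.join M M' := ⟨Or.inl hxy,
      fun z hz => Or.inl ((hN hM).2.1 _ _ _ hxy hz), fun z hz => Or.inr (hx z hz)⟩
    obtain ⟨x', hx', hp⟩ := (ho _ hJ _ hM').1 (leX_join_right (hN hM) (hN hM')) x y hxJ
    rcases hp with rfl | hp
    exacts [T.prefY_irrefl _ _ (hy _ hx'), not_prefY_symm hp (hy _ hx')]
  exact fun M hM M' hM' => ⟨key M hM M' hM', key M' hM' M hM⟩

section Finite

variable [Finite X] [Finite Y]

theorem InternallyClosed.joinClosed {N : Set (Set (X × Y))} (h : T.InternallyClosed N)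
    (hN : N ⊆ T.matchings) : T.JoinClosed N := by
  intro M hM M' hM'
  rw [h.eq_stableMatchings hN] at hM hM' ⊢
  rw [← (restrict_isSubtable T _).join_eq hM.1.1 hM'.1.1]
  exact join_mem_stableMatchings hM hM'

theorem InternallyStable.oppositionOfInterests {N : Set (Set (X × Y))}
    (h : T.InternallyStable N) (hN : N ⊆ T.matchings) : T.OppositionOfInterests N :=
  fun _ hM _ hM' => ⟨(h.compatible hN hM' hM).leY_of_leX, (h.compatible hN hM hM').leX_of_leY⟩

theorem internallyClosed_iff_maximal {N : Set (Set (X × Y))} (hN : N ⊆ T.matchings) :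
    T.InternallyClosed N ↔ Maximal (fun N' : Set (Set (X × Y)) =>
      N' ⊆ T.matchings ∧ T.JoinClosed N' ∧ T.OppositionOfInterests N') N := by
  constructor
  · intro h
    refine ⟨⟨hN, h.joinClosed hN, h.1.oppositionOfInterests hN⟩, ?_⟩
    rintro N' ⟨hN', hj, ho⟩ hle M hM
    exact ((internallyClosed_iff hN).1 h).2 M (hN' hM) fun K hK =>
      (internallyStable_of_joinClosed hN' hj ho).compatible hN' hM (hle hK)
  · rintro ⟨⟨-, hj, ho⟩, hmax⟩
    have hs := internallyStable_of_joinClosed hN hj ho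
    -- A maximal internally stable extension of `N` is internally closed, so it competes in the
    -- maximality of `N` and equals it.
    obtain ⟨N', hle, ⟨hN', hs'⟩, hmax'⟩ := (Set.toFinite
      {N' : Set (Set (X × Y)) | N' ⊆ T.matchings ∧ T.InternallyStable N'}).exists_le_maximal
      (a := N) ⟨hN, hs⟩
    have hcl : T.InternallyClosed N' := by
      refine (internallyClosed_iff hN').2 ⟨hs', fun M hM hc => ?_⟩
      have := (mem_internalClosure_iff hs' hN').2 ⟨hM, hc⟩
      exact hmax' (y := {M} ∪ N')
        ⟨Set.union_subset (Set.singleton_subset_iff.2 hM) hN', this.2⟩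
        (Set.subset_union_right) (Or.inl rfl)
    obtain rfl : N = N' := Set.Subset.antisymm hle
      (hmax ⟨hN', hcl.joinClosed hN', hs'.oppositionOfInterests hN'⟩ hle)
    exact hcl

end Finite

/-! ### Cycles of the generalized rotation digraphs -/

theorem exists_isPreRotation [Finite X] (hM : M ∈ T.matchings) (h : ¬ Acyclic (T.ArcX M)) :
    ∃ ρ, T.IsPreRotation M ρ := by
  simp only [Acyclic, not_forall, not_not] at h
  have hstep : ∀ x v, Relation.TransGen (T.ArcX M) (Sum.inl x) v → (∃ x', v = Sum.inl x') →
      ∃ y x', T.ArcX M (Sum.inl x) (Sum.inr y) ∧ T.ArcX M (Sum.inr y) (Sum.inl x') ∧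
        Relation.ReflTransGen (T.ArcX M) (Sum.inl x') v := by
    rintro x v hv ⟨z, rfl⟩
    obtain ⟨w, hw, hwv⟩ := Relation.TransGen.head'_iff.1 hv
    rcases w with w | y
    · exact hw.elim
    rcases Relation.ReflTransGen.cases_head hwv with e | ⟨u, hu, huv⟩
    · cases e
    rcases u with x' | u
    · exact ⟨y, x', hw, hu, huv⟩
    · exact hu.elim
  -- Applied to the `x` on closed walks: two arcs `x → y → x'` along such a walk lead to another of
  -- them.
  obtain ⟨ρ, h₀, h₁, h₂, h₃, h₄⟩ := exists_pairCycle (L := M) hM.2.2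
    (D := {x | Relation.TransGen (T.ArcX M) (Sum.inl x) (Sum.inl x)})
    (r := fun x x' => ∃ y, T.ArcX M (Sum.inl x) (Sum.inr y) ∧ (x', y) ∈ M) (by
      obtain ⟨x | y, hv⟩ := h
      · exact ⟨x, hv⟩
      · obtain ⟨w, hw, hwv⟩ := Relation.TransGen.head'_iff.1 hv
        rcases w with x | w
        · exact ⟨x, Relation.TransGen.tail' hwv hw⟩
        · exact hw.elim) (by
      intro x hx
      obtain ⟨y, x', ⟨-, -, y', hy', -⟩, -⟩ := hstep x _ hx ⟨x, rfl⟩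
      exact ⟨y', hy'⟩) (by
      intro x hx
      obtain ⟨y, x', ha, hb, hr⟩ := hstep x _ hx ⟨x, rfl⟩
      exact ⟨x', Relation.TransGen.tail' (hr.tail ha) hb, y, ha, hb⟩)
  refine ⟨ρ, h₀, h₁, h₂, fun p hp => (h₃ p hp).1, fun p q hpq => ?_⟩
  obtain ⟨y, ⟨-, hy, y', hy', hlt⟩, hq⟩ := h₄ p q hpq
  obtain rfl : q.2 = y := hM.2.1 _ _ _ (h₃ q hpq.mem_right).1 hq
  obtain rfl : p.2 = y' := hM.2.1 _ _ _ (h₃ p hpq.mem_left).1 hy'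
  exact ⟨hy _ hq, hlt⟩

/-- Rotating an `X`-minimal matching along a cycle of its digraph does not create blocking
pairs. -/
theorem exists_compatible_of_not_acyclicX [Finite X] [Finite Y] (hM : M ∈ T.matchings)
    (h : ¬ Acyclic (T.ArcX M)) :
    ∃ L ∈ T.matchings, (∀ K, T.Compatible M K → T.LeX M K → T.Compatible L K) ∧
      ¬ T.LeX M L := by
  obtain ⟨ρ, hρ⟩ := exists_isPreRotation hM h
  have hL := hρ.eliminate_mem_matchings hM
  refine ⟨_, hL, fun K hc hle => ⟨hL, hc.2.1, ?_, ?_⟩, fun hle => ?_⟩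
  · rintro ⟨x, y, ⟨hxy, -⟩ | ⟨p, q, hpq, e⟩, hb⟩
    · exact hc.2.2.1 ⟨x, y, hxy, hb⟩
    · obtain ⟨rfl, rfl⟩ := Prod.mk.inj e
      have hlt := (hρ.2.2.2.2 p q hpq).2
      obtain ⟨z, hz, hzp⟩ := hle p.1 p.2 (hρ.2.2.2.1 p hpq.mem_left)
      rcases hzp with rfl | hzp
      · exact not_prefX_symm hlt (hb.2.1 _ hz)
      · exact not_prefX_symm hlt (T.prefX_trans _ _ _ _ (hb.2.1 _ hz) hzp)
  -- Each `y` weakly improves from `K` to `M` and from `M` to the rotated matching, so no edge of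
  -- `K` can attract it.
  · rintro ⟨x, y, hxy, hb⟩
    obtain ⟨x₁, h₁, h₁x⟩ := hc.leY_of_leX hle x y hxy
    obtain ⟨x₂, h₂, h₂x⟩ := hρ.leY_eliminate hM x₁ y h₁
    have hx₂ := hb.2.2 x₂ h₂
    have hx₁ : T.prefY y x x₁ := by
      rcases h₂x with rfl | h₂x
      exacts [hx₂, T.prefY_trans _ _ _ _ hx₂ h₂x]
    rcases h₁x with rfl | h₁x
    exacts [T.prefY_irrefl _ _ hx₁, not_prefY_symm hx₁ h₁x]
  · obtain ⟨p, hp⟩ := exists_mem_of_ne_nil hρ.1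
    obtain ⟨q, hpq⟩ := exists_follows hp
    have hlt := (hρ.2.2.2.2 p q hpq).2
    rcases hle.eq_or_prefX hL (hρ.2.2.2.1 p hp) (hpq.mem_eliminate M) with e | e
    exacts [ne_of_prefX hlt e.symm, not_prefX_symm hlt e]

theorem ArcY.swap {u v : X ⊕ Y} (h : T.ArcY M u v) : T.swap.ArcX (swapM M) u.swap v.swap := by
  rcases u with x | y <;> rcases v with x' | y'
  · exact h
  · exact h
  · exact h
  · exact h

theorem ArcX.swap {u v : X ⊕ Y} (h : T.ArcX M u v) : T.swap.ArcY (swapM M) u.swap v.swap := by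
  rcases u with x | y <;> rcases v with x' | y'
  · exact h
  · exact h
  · exact h
  · exact h

theorem acyclic_swap_iff : Acyclic (T.swap.ArcX (swapM M)) ↔ Acyclic (T.ArcY M) :=
  ⟨fun h v hv => h v.swap (hv.lift Sum.swap fun _ _ => ArcY.swap),
    fun h v hv => h v.swap (hv.lift Sum.swap fun _ _ => ArcX.swap (T := T.swap))⟩

theorem exists_compatible_of_not_acyclicY [Finite X] [Finite Y] (hM : M ∈ T.matchings)
    (h : ¬ Acyclic (T.ArcY M)) :
    ∃ L ∈ T.matchings, (∀ K, T.Compatible M K → T.LeY M K → T.Compatible L K) ∧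
      ¬ T.LeY M L := by
  obtain ⟨L, hL, hc, hle⟩ := exists_compatible_of_not_acyclicX (swapM_mem_matchings hM)
    fun hac => h (acyclic_swap_iff.1 hac)
  exact ⟨swapM L, swapM_mem_matchings hL, fun K hK hMK =>
    (hc (swapM K) hK.swap (swap_leX.2 hMK)).swap, fun hML => hle (swap_leX.2 hML)⟩

/-- If `x` prefers `M`, its `M'`-partner `y` prefers `M'`, giving arcs `x → y → x'` to the
`M`-partner `x'` of `y`, which again prefers `M`. A finite acyclic digraph admits no endless walk.
-/
theorem Compatible.not_betterX_of_acyclic [Finite X] [Finite Y] (h : T.Compatible M M')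
    (hac : Acyclic (T.ArcX M)) (x : X) : ¬ T.BetterX M M' x := by
  intro hx
  let r : X → X → Prop := fun a b => Relation.TransGen (T.ArcX M) (Sum.inl b) (Sum.inl a)
  have : IsTrans X r := ⟨fun _ _ _ h h' => h'.trans h⟩
  have : Std.Irrefl r := ⟨fun a => hac _⟩
  obtain ⟨x, hx, hmin⟩ := (Finite.wellFounded_of_trans_of_irrefl r).has_min
    {x | T.BetterX M M' x} ⟨x, hx⟩
  obtain ⟨a, ha, -⟩ := id hx
  obtain ⟨y, hy⟩ := h.exists_mem_right ha
  have hB := h.betterY_of_mem_right hy hx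
  obtain ⟨x', hx'⟩ := h.symm.exists_mem_left hy
  refine hmin x' (h.betterX_of_mem_left hx' hB) (.tail (b := Sum.inr y) (.single ?_) hx')
  exact ⟨h.2.1.1 hy, fun z hz => hB.prefY h.2.1 hy hz, a, ha, hx.prefX h.1 ha hy⟩

theorem Compatible.not_betterY_of_acyclic [Finite X] [Finite Y] (h : T.Compatible M M')
    (hac : Acyclic (T.ArcY M)) (y : Y) : ¬ T.BetterY M M' y :=
  h.swap.not_betterX_of_acyclic (acyclic_swap_iff.2 hac) y

end MarriageTable

namespace MarriageTable

variable {X Y : Type*} {T T' : MarriageTable X Y} {M M' : Set (X × Y)} {ρ σ : PairCycle X Y}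

/-! ### Dissecting sets -/

theorem IsSubtable.augment (h : T'.IsSubtable T) (R : Set (PairCycle X Y)) :
    T'.IsSubtable (augment T T' R) :=
  isSubtable_of_subset h (restrict_isSubtable T _) fun _ he => ⟨h.1 he, Or.inl he⟩

/-- A dissecting set avoids the rotations of `T'`, so `{ρ}` can only be the default output. -/
theorem isDROutput_singleton_iff (hρ : ρ ∈ T'.rotations) :
    IsDROutput T T' ρ {ρ} ↔ ¬ ∃ R, IsDissectingSet T T' ρ R :=
  ⟨fun h => h.elim (fun h => absurd hρ (h.2.1 rfl).2) fun h => h.1, fun h => Or.inr ⟨h, rfl⟩⟩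

variable [Finite X] [Finite Y]

/-- A stable table whose stable matchings form an internally closed set has no dissecting sets. -/
theorem not_isDissectingSet (hsub : T'.IsSubtable T) (hT' : T'.IsStableTable)
    (hc : ∀ M ∈ T.matchings, (∀ K ∈ T'.stableMatchings, T.Compatible M K) →
      M ∈ T'.stableMatchings) (R : Set (PairCycle X Y)) : ¬ IsDissectingSet T T' ρ R := by
  rintro ⟨-, hR, MX, M₀, M₁, -, -, ⟨hρ, hM₁⟩, l, -, rfl, hl⟩
  obtain rfl : M₁ = eliminate M₀ ρ := hM₁
  set S := augment T T' {σ | σ ∈ l} with hS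
  have hST : S.IsSubtable T := restrict_isSubtable T _
  have hTS : T'.IsSubtable S := hsub.augment _
  cases l with
  | nil =>
    have e : eliminate M₀ ρ = M₀ := hl
    exact hρ.not_leX_eliminate (e.symm ▸ LeX.refl T' M₀)
  | cons σ l =>
    obtain ⟨hσ, hl⟩ := hl
    have hL := hσ.eliminate_mem_stableMatchings
    have hM₀ := hσ.1
    have hM₁ := hl.mem_stableMatchings hL
    have c₀ := compatible_of_stable hM₀ hL
    have c₁ := compatible_of_stable hL hM₁
    -- Already the first elimination from the dissecting set leads to a matching compatible with all
    -- stable matchings of `T'`; closedness then makes `σ` a rotation of `T'`.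
    have hL' : eliminate M₀ σ ∈ T'.stableMatchings := by
      refine hc _ (hST.matchings_subset hL.1) fun K hK =>
        ⟨hST.matchings_subset hL.1, hsub.matchings_subset hK.1, ?_, ?_⟩
      · rintro ⟨x, y, hxy, hb⟩
        by_cases he : (x, y) ∈ T'.edges
        · exact (hsub.mem_stableMatchings_iff.1 hK).2.2 x y he hb
        obtain ⟨a, ha⟩ := c₀.symm.exists_mem_right hxy
        obtain ⟨b, hb₁⟩ := c₁.exists_mem_right hxy
        have hay : S.prefX x a y :=
          (hσ.isPreRotation.eliminate_leX.eq_or_prefX hM₀.1 hxy ha).resolve_left (by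
            rintro rfl
            exact he (hρ.1.1.1 ha))
        have hyb : S.prefX x y b := (hl.leX.eq_or_prefX hL.1 hb₁ hxy).resolve_left (by
          rintro rfl
          exact he (hρ.eliminate_mem_stableMatchings.1.1 hb₁))
        -- The blocking edge `xy` is new, so `y` lies strictly between the partners of `x` in `M₀`
        -- and `M₁`; hence `ρ` moves `x`.
        have hxρ : ∃ p ∈ ρ, p.1 = x := by
          by_contra hn
          push Not at hn
          obtain rfl := hM₁.1.2.1 _ _ _ (Or.inl ⟨ha, hn⟩) hb₁
          exact not_prefX_symm hay hyb
        obtain ⟨p, hp, rfl⟩ := hxρ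
        obtain ⟨k, hk⟩ := (compatible_of_stable hρ.1 hK).exists_mem_right ha
        have hak : T'.prefX p.1 a k := (hsub.2.1 _ _ _ (hρ.1.1.1 ha) (hK.1.1 hk)).2
          (T.prefX_trans _ _ _ _ (hST.prefX hay) (hb.2.1 k hk))
        -- As `x` loses from `M₀` to `K`, so does all of `ρ`. Thus `y` gets from `K` at least its
        -- partner in `M₁`, which it prefers to `x`, and `xy` cannot block `K`.
        have hall := hT'.forall_betterX hρ hK hp (betterX_of_prefX hK.1 ha hk hak)
        have hB₀ := c₀.betterY_of_mem_right hxy (betterX_of_prefX hL.1 ha hxy hay)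
        obtain ⟨z, hz, hzb⟩ := c₁.betterY_of_mem hxy (betterX_of_prefX hM₁.1 hxy hb₁ hyb)
        have hzx := hzb _ hxy
        rcases hz with ⟨hz, -⟩ | ⟨p', q', hpq', e⟩
        · exact not_prefY_symm hzx (hB₀.prefY hL.1 hxy hz)
        obtain ⟨rfl, rfl⟩ := Prod.mk.inj e
        obtain ⟨w, hw, hwp⟩ := hT'.exists_mem_right hρ hK hpq' (hall p' hpq'.mem_left)
        have hxw := hb.2.2 w hw
        have hzx := hST.prefY hzx
        rcases hwp with rfl | hwp
        · exact not_prefY_symm hxw hzx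
        · exact not_prefY_symm hxw (T.prefY_trans _ _ _ _ (hsub.prefY hwp) hzx)
      · rintro ⟨x, y, hxy, hb⟩
        exact (hST.mem_stableMatchings_iff.1 hL).2.2 x y (hTS.1 (hK.1.1 hxy)) hb
    refine (hR (show σ ∈ {τ | τ ∈ σ :: l} by simp)).2 ⟨M₀, hTS.exposed hσ hρ.1 ?_⟩
    exact fun e he => hL'.1.1 (Or.inr he)

/-- A stable matching of a larger stable table that uses a new edge between the `X`-optimal and
the `Y`-optimal stable matching of `T'` yields a dissecting set. -/
theorem exists_isDissectingSet_of_mem (hsub : T'.IsSubtable T) (hT' : T'.IsStableTable)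
    {S : MarriageTable X Y} (hST : S.IsSubtable T) (hTS : T'.IsSubtable S)
    (hstab : ∀ K ∈ T'.stableMatchings, K ∈ S.stableMatchings)
    {MX MY : Set (X × Y)} (hX : T'.IsXOptimal MX) (hY : T'.IsYOptimal MY)
    (hM : M ∈ S.stableMatchings) {x : X} {y a b : Y} (hxy : (x, y) ∈ M)
    (hnew : (x, y) ∉ T'.edges) (ha : (x, a) ∈ MX) (hb : (x, b) ∈ MY) (hay : S.prefX x a y)
    (hyb : S.prefX x y b) : ∃ ρ ∈ T'.rotations, ∃ R, IsDissectingSet T T' ρ R := by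
  obtain ⟨l, hl⟩ := exists_eliminatesTo hX.1 hY.1 (hY.leX hX.1)
  obtain ⟨ρ, hρl, p, q, hpq, rfl, hpy, hqy⟩ := hl.exists_crossing hX.1 (fun z => S.prefX x z y)
    ha hb hay (not_prefX_symm hyb)
  obtain ⟨L, hL, -⟩ := hl.exists_exposed hρl
  have hρ : ρ ∈ T'.rotations := ⟨L, hL⟩
  obtain ⟨M₀, hset, hex⟩ := hT'.exists_eliminatesSetTo hρ hX hY
  have hM₁ := hex.eliminate_mem_stableMatchings
  set M₁ := eliminate M₀ ρ with hM₁def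
  have hp₀ : (p.1, p.2) ∈ M₀ := hex.2.2.2.2.1 p hpq.mem_left
  have hq₁ : (p.1, q.2) ∈ M₁ := hpq.mem_eliminate M₀
  have hyq : S.prefX p.1 y q.2 := by
    refine (S.prefX_total _ _ _ (hM.1.1 hxy) (hTS.1 (hM₁.1.1 hq₁)) ?_).resolve_right hqy
    rintro rfl
    exact hnew (hM₁.1.1 hq₁)
  have s₀ := hstab _ hex.1
  have s₁ := hstab _ hM₁
  have hJ := join_mem_stableMatchings hM s₁
  have hyJ : (p.1, y) ∈ S.join M M₁ := ⟨Or.inl hxy, fun z hz => Or.inl (hM.1.2.1 _ _ _ hxy hz),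
    fun z hz => Or.inr (s₁.1.2.1 _ _ _ hq₁ hz ▸ hyq)⟩
  -- `V = (M ∨ M₁) ∧ M₀` still contains the new edge and lies between `M₁` and `M₀`, so the passage
  -- from `M₀` to `M₁` can be made through it.
  obtain ⟨V, hV, hVsub, hVJ, hV₀, hVmax⟩ := exists_meet hJ s₀
  have hyV : (p.1, y) ∈ V := by
    obtain ⟨v, hv⟩ := (compatible_of_stable hJ hV).exists_mem_right hyJ
    rcases hVsub hv with h | h
    · exact hJ.1.2.1 _ _ _ h hyJ ▸ hv
    · obtain rfl := hex.1.1.2.1 _ _ _ h hp₀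
      rcases hVJ.eq_or_prefX hJ.1 hv hyJ with e | e
      exacts [absurd e.symm (ne_of_prefX hpy), absurd e (not_prefX_symm hpy)]
  have h₁V : S.LeX M₁ V := hVmax M₁ s₁ (leX_join_right hM.1 s₁.1)
    (hTS.leX hex.isPreRotation.eliminate_leX)
  obtain ⟨l₁, hl₁⟩ := exists_eliminatesTo s₀ hV hV₀
  obtain ⟨l₂, hl₂⟩ := exists_eliminatesTo hV s₁ h₁V
  have hfull := hl₁.append hl₂
  have hedges : ∀ σ ∈ l₁ ++ l₂, rotEdges σ ⊆ S.edges := fun σ hσ =>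
    let ⟨_, h, _⟩ := hfull.exists_exposed hσ
    h.rotEdges_subset
  set A := augment T T' {σ | σ ∈ l₁ ++ l₂} with hA
  have hAE : ∀ σ ∈ l₁ ++ l₂, rotEdges σ ⊆ A.edges := fun σ hσ e he =>
    ⟨hST.1 (hedges σ hσ he), Or.inr (Set.mem_biUnion hσ he)⟩
  have hAS : A.IsSubtable S := by
    refine isSubtable_of_subset (restrict_isSubtable T _) hST ?_
    rintro e ⟨-, he | he⟩
    · exact hTS.1 he
    · obtain ⟨σ, hσ, he⟩ := Set.mem_iUnion₂.1 he
      exact hedges σ hσ he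
  have hfullA : A.EliminatesTo M₀ (l₁ ++ l₂) M₁ := hAS.eliminatesTo hfull
    (hAS.mem_stableMatchings_of_subset s₀ (hex.1.1.1.trans (hsub.augment _).1))
    fun σ hσ e he => hAE σ hσ (Or.inr he)
  refine ⟨ρ, hρ, {σ | σ ∈ l₁ ++ l₂}, fun σ hσ => (hedges σ hσ).trans hST.1, ?_,
    MX, M₀, M₁, hX, hset, ⟨hex, rfl⟩, l₁ ++ l₂, hfull.nodup, rfl, hfullA⟩
  intro σ hσ
  refine ⟨?_, fun hσ' => ?_⟩
  · obtain ⟨K, hK, -⟩ := hfullA.exists_exposed hσ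
    exact ⟨K, hK⟩
  obtain ⟨K, hK, hK₀, hK₁⟩ := hfull.exists_exposed hσ
  obtain ⟨K', hK'⟩ := id hσ'
  obtain ⟨r, hr⟩ := exists_mem_of_ne_nil hK.2.1
  obtain ⟨s, hrs⟩ := exists_follows hr
  have hrK : (r.1, r.2) ∈ K := hK.2.2.2.2.1 r hr
  have hlt := (hK.2.2.2.2.2 r s hrs).2.1
  obtain ⟨c, hc⟩ := (compatible_of_stable hK.1 s₀).exists_mem_right hrK
  obtain ⟨d, hd⟩ := (compatible_of_stable hK.1 s₁).exists_mem_right hrK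
  have hcr := hK₀.eq_or_prefX s₀.1 hrK hc
  have hrd : S.prefX r.1 r.2 d := by
    rcases hK₁.eq_or_prefX hK.eliminate_mem_stableMatchings.1 hd (hrs.mem_eliminate K) with e | e
    exacts [e ▸ hlt, S.prefX_trans _ _ _ _ hlt e]
  -- The agent `r.1` moves between `M₀` and `M₁`, hence lies on `ρ`. If `σ` is a rotation of `T'`,
  -- then `r` is an edge of `T'`, and the absence of gaps forces `r` to be a pair of `ρ`.
  have hrρ : r ∈ ρ := by
    have hr₁ : ∃ p' ∈ ρ, p'.1 = r.1 := by
      by_contra hn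
      push Not at hn
      obtain rfl := s₁.1.2.1 _ _ _ (Or.inl ⟨hc, hn⟩) hd
      rcases hcr with e | e
      exacts [ne_of_prefX hrd e.symm, not_prefX_symm hrd e]
    obtain ⟨p', hp', e⟩ := hr₁
    obtain ⟨q', hpq'⟩ := exists_follows hp'
    obtain rfl : p'.2 = c := s₀.1.2.1 _ _ _ (e ▸ hex.2.2.2.2.1 p' hp') hc
    obtain rfl : q'.2 = d := s₁.1.2.1 _ _ _ (e ▸ hpq'.mem_eliminate M₀) hd
    rcases hcr with e' | e'
    · exact Prod.ext e e' ▸ hp'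
    · have hrT : (r.1, r.2) ∈ T'.edges := hK'.rotEdges_subset (Or.inl hr)
      exact absurd ((hTS.2.1 _ _ _ (e ▸ hrT) (hM₁.1.1 (e ▸ hd))).2 (e ▸ hrd))
        (hT'.not_between_left hex hpq'
          ((hTS.2.1 _ _ _ (hex.1.1.1 (e ▸ hc)) (e ▸ hrT)).2 (e ▸ e')))
  obtain rfl := hT'.eq_of_mem hσ' hρ hr hrρ
  -- Now `σ = ρ` takes `p.1` from `p.2` to `q.2` in one move, skipping `y`. It can occur neither
  -- before nor after `V`, where `p.1` is matched to `y`.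
  rcases List.mem_append.1 hσ with h | h
  · obtain ⟨W, hW, -, hVW⟩ := hl₁.exists_exposed h
    rcases hVW.eq_or_prefX hW.eliminate_mem_stableMatchings.1 hyV (hpq.mem_eliminate W) with e | e
    exacts [ne_of_prefX hyq e.symm, not_prefX_symm hyq e]
  · obtain ⟨W, hW, hWV, -⟩ := hl₂.exists_exposed h
    rcases hWV.eq_or_prefX hV.1 (hW.2.2.2.2.1 p hpq.mem_left) hyV with e | e
    exacts [ne_of_prefX hpy e.symm, not_prefX_symm hpy e]

theorem exists_isDissectingSet (hsub : T'.IsSubtable T) (hT' : T'.IsStableTable)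
    {MX MY : Set (X × Y)} (hX : T'.IsXOptimal MX) (hY : T'.IsYOptimal MY)
    (hacX : Acyclic (T.ArcX MY)) (hacY : Acyclic (T.ArcY MX)) (hM : M ∈ T.matchings)
    (hc : ∀ K ∈ T'.stableMatchings, T.Compatible M K) (hn : M ∉ T'.stableMatchings) :
    ∃ ρ ∈ T'.rotations, ∃ R, IsDissectingSet T T' ρ R := by
  have hMT' : ∀ x y, (x, y) ∈ T'.edges → ¬ T.IsBlockingPair M x y := by
    intro x y hxy hb
    obtain ⟨K, hK, hxK⟩ := hT' _ hxy
    exact (hc K hK).2.2.2 ⟨x, y, hxK, hb⟩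
  have hnew : ∃ x y, (x, y) ∈ M ∧ (x, y) ∉ T'.edges := by
    by_contra hcon
    push Not at hcon
    exact hn (hsub.mem_stableMatchings_iff.2 ⟨hM, fun e he => hcon e.1 e.2 he, hMT'⟩)
  obtain ⟨x, y, hxy, hxy'⟩ := hnew
  let S := T.restrict (T'.edges ∪ M)
  have hST : S.IsSubtable T := restrict_isSubtable T _
  have hTS : T'.IsSubtable S := isSubtable_of_subset hsub hST fun e he => ⟨hsub.1 he, Or.inl he⟩
  have hMS : M ∈ S.stableMatchings := by
    refine hST.mem_stableMatchings_iff.2 ⟨hM, fun e he => ⟨hM.1 he, Or.inr he⟩, ?_⟩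
    rintro x y ⟨-, h | h⟩ hb
    exacts [hMT' x y h hb, not_blocks_self T M ⟨x, y, h, hb⟩]
  have hstab : ∀ K ∈ T'.stableMatchings, K ∈ S.stableMatchings := by
    intro K hK
    obtain ⟨h₁, h₂, h₃⟩ := hsub.mem_stableMatchings_iff.1 hK
    refine hST.mem_stableMatchings_iff.2 ⟨h₁, h₂.trans hTS.1, ?_⟩
    rintro x y ⟨-, h | h⟩ hb
    exacts [h₃ x y h hb, (hc K hK).2.2.1 ⟨x, y, h, hb⟩]
  have cX := compatible_of_stable hMS (hstab _ hX.1)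
  have cY := compatible_of_stable hMS (hstab _ hY.1)
  obtain ⟨a, ha⟩ := cX.exists_mem_right hxy
  obtain ⟨b, hb⟩ := cY.exists_mem_right hxy
  refine exists_isDissectingSet_of_mem hsub hT' hST hTS hstab hX hY hMS hxy hxy' ha hb ?_ ?_
  -- Acyclicity keeps `M` between the extremes: no `Y`-agent prefers `MX` to `M`, and below, no
  -- `X`-agent prefers `MY` to `M`.
  · refine (S.prefX_total _ _ _ (cX.2.1.1 ha) (hMS.1.1 hxy) ?_).resolve_right fun hp => ?_
    · rintro rfl
      exact hxy' (hX.1.1.1 ha)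
    · have h := hc _ hX.1
      exact h.symm.not_betterY_of_acyclic hacY y (h.betterY_of_mem hxy
        (betterX_of_prefX h.2.1 hxy ha (hST.prefX hp)))
  · refine (S.prefX_total _ _ _ (hMS.1.1 hxy) (cY.2.1.1 hb) ?_).resolve_right fun hp => ?_
    · rintro rfl
      exact hxy' (hY.1.1.1 hb)
    · exact (hc _ hY.1).symm.not_betterX_of_acyclic hacX x
        (betterX_of_prefX hM hb hxy (hST.prefX hp))

/-! ### Internal closedness and stable tables without dissecting sets -/

theorem InternallyClosed.exists_stableTable {N : Set (Set (X × Y))} (h : T.InternallyClosed N)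
    (hN : N ⊆ T.matchings) :
    ∃ T' : MarriageTable X Y, T'.IsSubtable T ∧ T'.IsStableTable ∧ N = T'.stableMatchings ∧
      (∃ MX MY : Set (X × Y), T'.IsXOptimal MX ∧ T'.IsYOptimal MY ∧
        Acyclic (T.ArcX MY) ∧ Acyclic (T.ArcY MX)) ∧
      ∀ ρ ∈ T'.rotations, IsDROutput T T' ρ {ρ} := by
  have hsub := restrict_isSubtable T (⋃₀ N)
  have hT' := h.1.isStableTable hN
  have heq := h.eq_stableMatchings hN
  have hne := h.nonempty hN
  have hc := ((internallyClosed_iff hN).1 h).2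
  generalize T.restrict (⋃₀ N) = T' at *
  subst heq
  obtain ⟨MX, hX⟩ := exists_isXOptimal hne
  obtain ⟨MY, hY⟩ := exists_isYOptimal hne
  refine ⟨T', hsub, hT', rfl, ⟨MX, MY, hX, hY, ?_, ?_⟩, fun ρ hρ => ?_⟩
  · by_contra hac
    -- Closedness would put the rotated matching `L` into the family although it is not above `MY`,
    -- the `X`-minimum.
    obtain ⟨L, hL, hcL, hle⟩ := exists_compatible_of_not_acyclicX (hN hY.1) hac
    have hL' := hc L hL fun K hK => hcL K (hsub.compatible hY.1 hK) (hsub.leX (hY.leX hK))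
    exact hle (hsub.leX (hY.leX hL'))
  · by_contra hac
    obtain ⟨L, hL, hcL, hle⟩ := exists_compatible_of_not_acyclicY (hN hX.1) hac
    have hleY : ∀ K ∈ T'.stableMatchings, T.LeY MX K := fun K hK =>
      hsub.leY ((compatible_of_stable hK hX.1).leY_of_leX (hX.2 K hK))
    exact hle (hleY L (hc L hL fun K hK => hcL K (hsub.compatible hX.1 hK) (hleY K hK)))
  · exact (isDROutput_singleton_iff hρ).2 fun ⟨R, hR⟩ => not_isDissectingSet hsub hT' hc R hR

theorem internallyClosed_stableMatchings (hsub : T'.IsSubtable T) (hT' : T'.IsStableTable)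
    {MX MY : Set (X × Y)} (hX : T'.IsXOptimal MX) (hY : T'.IsYOptimal MY)
    (hacX : Acyclic (T.ArcX MY)) (hacY : Acyclic (T.ArcY MX))
    (hDR : ∀ ρ ∈ T'.rotations, IsDROutput T T' ρ {ρ}) :
    T.InternallyClosed T'.stableMatchings := by
  refine (internallyClosed_iff fun M hM => hsub.matchings_subset hM.1).2
    ⟨fun M hM M' hM' => (hsub.compatible hM hM').2.2, fun M hM hc => ?_⟩
  by_contra hn
  obtain ⟨ρ, hρ, hR⟩ := exists_isDissectingSet hsub hT' hX hY hacX hacY hM hc hn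
  exact (isDROutput_singleton_iff hρ).1 (hDR ρ hρ) hR

end MarriageTable

theorem mainTheorem1 {X Y : Type*} [Finite X] [Finite Y] (T : MarriageTable X Y)
    (N : Set (Set (X × Y))) (hN : N ⊆ T.matchings) :
    List.TFAE [
      T.InternallyClosed N,
      Maximal (fun N' : Set (Set (X × Y)) =>
        N' ⊆ T.matchings ∧ T.JoinClosed N' ∧ T.OppositionOfInterests N') N,
      ∃ T' : MarriageTable X Y, T'.IsSubtable T ∧ T'.IsStableTable ∧
        N = T'.stableMatchings ∧
        (∃ MX MY : Set (X × Y), T'.IsXOptimal MX ∧ T'.IsYOptimal MY ∧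
          MarriageTable.Acyclic (T.ArcX MY) ∧ MarriageTable.Acyclic (T.ArcY MX)) ∧
        (∀ ρ ∈ T'.rotations, MarriageTable.IsDROutput T T' ρ {ρ})] := by
  tfae_have 1 ↔ 2 := MarriageTable.internallyClosed_iff_maximal hN
  tfae_have 1 → 3 := fun h => h.exists_stableTable hN
  tfae_have 3 → 1 := by
    rintro ⟨T', hsub, hT', rfl, ⟨MX, MY, hX, hY, hacX, hacY⟩, hDR⟩
    exact MarriageTable.internallyClosed_stableMatchings hsub hT' hX hY hacX hacY hDR
  tfae_finish
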